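/- **Setting.** Let $A\in\mathbb R^{n\times m}$, $n<m$, be a random matrix whose entries are independent $\mathcal N(0,1/n)$ random variables, let $x\in\mathbb R^m$ be a fixed vector with at most $k\ge 1$ nonzero entries, and let $y=Ax$. Accelerated Orthogonal Least-Squares (AOLS) with input $y$, $A$, sparsity level $k$, number $L$ of selections per iteration ($1\le L\le\lfloor n/k\rfloor$) and threshold $\epsilon>0$ is the following algorithm. Start with $\mathcal S=\emptyset$, $r=y$ and $t_j=a_j$ (the $j$-th column of $A$). Throughout, write $q_j=\frac{a_j^\top r}{a_j^\top t_j}\,t_j$. While $\|r\|_2\ge\epsilon$ and fewer than $k$ iterations have been made: select $L$ indices $j\notin\mathcal S$ with the $L$ largest values $\|q_j\|_2$ (ties broken arbitrarily), add them to $\mathcal S$, and for each of them in turn put $u=q_j$ (computed from the current $r$ and $t_j$), replace $r$ by $r-u$, and replace every $t_l$ by $t_l-\frac{t_l^\top u}{\|u\|_2^2}u$. Finally output the estimate $\hat x$ that equals $(A_{\mathcal S}^\top A_{\mathcal S})^{-1}A_{\mathcal S}^\top y$ on $\mathcal S$ and $0$ elsewhere, where $A_{\mathcal S}$ consists of the columns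 of $A$ with indices in $\mathcal S$. We say that AOLS recovers $x$ in at most $k$ iterations if, for all sufficiently small $\epsilon>0$, it terminates after at most $k$ iterations with $\hat x=x$, however ties are broken. **Statement.** For every integer $L\ge1$ there are positive constants $C_1,C_2,C_3$, independent of $\beta$, $n$, $m$, $k$ and $x$, such that the following holds. Suppose that $0<\beta<1$, $k\ge1$, $L\le\lfloor n/k\rfloor$, $n<m$, $m>(k+L-1)^{3/2}$ and $$n\ \ge\ \max\Big\{\frac{6}{C_1}\,k\log\frac{m}{(k+L-1)\sqrt[3]{\beta}},\ \frac{C_2k+\log\frac{8}{\beta^2}}{C_3}\Big\}.$$ Then, for every $x$ with at most $k$ nonzero entries, AOLS recovers $x$ from $y=Ax$ in at most $k$ iterations with probability exceeding $1-\beta^2$. In particular, $O\big(k\log\frac{m}{k+L-1}\big)$ measurements suffice: for every $L\ge1$ and $\beta\in(0,1)$ there is a constant $C>0$ such that, whenever $k\ge1$, $L\le\lfloor n/k\rfloor$, $n<m$, $m>(k+L-1)^{3/2}$ and $n\ge C\,k\log\frac{m}{k+L-1}$, for every $x$ with at most $k$ nonzero entries AOLS recovers $x$ from $y=Ax$ in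 at most $k$ iterations with probability exceeding $1-\beta^2$. -/

import Mathlib

universe u

namespace AOLS

/-- The `j`-th column of an `n × m` real matrix, as a vector of Euclidean space. -/
noncomputable def column {n m : ℕ} (A : Matrix (Fin n) (Fin m) ℝ) (j : Fin m) :
    EuclideanSpace ℝ (Fin n) :=
  WithLp.toLp 2 (fun i => A i j)

/-- The noiseless measurements `y = A x`. -/
noncomputable def measurements {n m : ℕ} (A : Matrix (Fin n) (Fin m) ℝ) (x : Fin m → ℝ) :
    EuclideanSpace ℝ (Fin n) :=
  WithLp.toLp 2 (A.mulVec x)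

/-- `x` has at most `k` nonzero entries. -/
def IsSparse {m : ℕ} (k : ℕ) (x : Fin m → ℝ) : Prop :=
  {j | x j ≠ 0}.ncard ≤ k

/-- The data maintained by the AOLS algorithm: the set `S` of selected indices, the residual `r`,
and the vectors `t j`. -/
structure State (n m : ℕ) where
  S : Finset (Fin m)
  r : EuclideanSpace ℝ (Fin n)
  t : Fin m → EuclideanSpace ℝ (Fin n)

/-- Initial state: nothing is selected, the residual is `y`, and `t j` is the `j`-th column. -/
noncomputable def State.init {n m : ℕ} (A : Matrix (Fin n) (Fin m) ℝ)
    (y : EuclideanSpace ℝ (Fin n)) : State n m where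
  S := ∅
  r := y
  t := column A

/-- `q_j = (a_jᵀ r / a_jᵀ t_j) t_j`. -/
noncomputable def State.q {n m : ℕ} (A : Matrix (Fin n) (Fin m) ℝ) (σ : State n m) (j : Fin m) :
    EuclideanSpace ℝ (Fin n) :=
  (inner ℝ (column A j) σ.r / inner ℝ (column A j) (σ.t j)) • σ.t j

/-- Processing of one selected index `j`: with `u = q_j`, the residual becomes `r - u` and every
`t_l` becomes `t_l - (t_lᵀ u / ‖u‖²) u`. -/
noncomputable def State.absorb {n m : ℕ} (A : Matrix (Fin n) (Fin m) ℝ) (σ : State n m)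
    (j : Fin m) : State n m where
  S := insert j σ.S
  r := σ.r - σ.q A j
  t := fun l => σ.t l - (inner ℝ (σ.t l) (σ.q A j) / ‖σ.q A j‖ ^ 2) • σ.q A j

/-- `l` lists `L` distinct not yet selected indices whose values `‖q_j‖` are the `L` largest ones
among all not yet selected indices (ties may be broken in any way). -/
def IsSelection {n m : ℕ} (A : Matrix (Fin n) (Fin m) ℝ) (L : ℕ) (σ : State n m)
    (l : List (Fin m)) : Prop :=
  l.Nodup ∧ l.length = L ∧ (∀ j ∈ l, j ∉ σ.S) ∧
    ∀ j ∈ l, ∀ j' : Fin m, j' ∉ σ.S → j' ∉ l → ‖σ.q A j'‖ ≤ ‖σ.q A j‖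

/-- `Run A y k L ε i σ`: the algorithm with input `y`, `A`, sparsity level `k`, `L` selections per
iteration and threshold `ε` can be in the state `σ` after `i` iterations. Another iteration is
made as long as `ε ≤ ‖r‖` and `i < k`; it selects `L` indices and then processes them one after the
other. -/
inductive Run {n m : ℕ} (A : Matrix (Fin n) (Fin m) ℝ) (y : EuclideanSpace ℝ (Fin n))
    (k L : ℕ) (ε : ℝ) : ℕ → State n m → Prop
  | start : Run A y k L ε 0 (State.init A y)
  | step {i : ℕ} {σ : State n m} {l : List (Fin m)} :
      Run A y k L ε i σ → ε ≤ ‖σ.r‖ → i < k → IsSelection A L σ l →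
      Run A y k L ε (i + 1) (l.foldl (State.absorb A) σ)

/-- The algorithm can terminate after `i` iterations in the state `σ`. -/
def Terminates {n m : ℕ} (A : Matrix (Fin n) (Fin m) ℝ) (y : EuclideanSpace ℝ (Fin n))
    (k L : ℕ) (ε : ℝ) (i : ℕ) (σ : State n m) : Prop :=
  Run A y k L ε i σ ∧ ¬ (ε ≤ ‖σ.r‖ ∧ i < k)

/-- The submatrix of the columns with indices in `S`. -/
def columnsOf {n m : ℕ} (A : Matrix (Fin n) (Fin m) ℝ) (S : Finset (Fin m)) :
    Matrix (Fin n) S ℝ :=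
  A.submatrix id (fun j : S => (j : Fin m))

/-- The estimate `A_S^† y` with `A_S^† = (A_Sᵀ A_S)⁻¹ A_Sᵀ`, extended by zero outside `S`. -/
noncomputable def estimate {n m : ℕ} (A : Matrix (Fin n) (Fin m) ℝ)
    (y : EuclideanSpace ℝ (Fin n)) (S : Finset (Fin m)) : Fin m → ℝ :=
  fun j => if h : j ∈ S then
    (((columnsOf A S).transpose * columnsOf A S)⁻¹ * (columnsOf A S).transpose).mulVec
      (fun i => y i) ⟨j, h⟩
  else 0

/-- AOLS recovers `x` from `y = A x` in at most `k` iterations: for every sufficiently small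
positive threshold `ε` the algorithm can be carried out to termination, and, however ties are
broken, it terminates after at most `k` iterations with the estimate `x`. -/
def Recovers {n m : ℕ} (A : Matrix (Fin n) (Fin m) ℝ) (x : Fin m → ℝ) (k L : ℕ) : Prop :=
  ∃ ε₀ : ℝ, 0 < ε₀ ∧ ∀ ε : ℝ, 0 < ε → ε ≤ ε₀ →
    (∃ i σ, Terminates A (measurements A x) k L ε i σ) ∧
    ∀ i σ, Terminates A (measurements A x) k L ε i σ →
      i ≤ k ∧ estimate A (measurements A x) σ.S = x

/-- The entries of the random `n × m` matrix `A` are independent `N(0, 1/n)` random variables. -/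
def IsGaussianMatrix {Ω : Type*} [MeasurableSpace Ω] (P : MeasureTheory.Measure Ω) {n m : ℕ}
    (A : Ω → Matrix (Fin n) (Fin m) ℝ) : Prop :=
  (∀ i j, ProbabilityTheory.HasLaw (fun ω => A ω i j)
    (ProbabilityTheory.gaussianReal 0 (n : NNReal)⁻¹) P) ∧
  ProbabilityTheory.iIndepFun (fun (ij : Fin n × Fin m) ω => A ω ij.1 ij.2) P

/-- For every `k`-sparse `x ∈ ℝᵐ` and every random `n × m` matrix `A` with independent `N(0, 1/n)`
entries, AOLS recovers `x` from `A x` in at most `k` iterations with probability exceeding `p`. -/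
def RecoversWithProb (n m k L : ℕ) (p : ℝ) : Prop :=
  ∀ (Ω : Type u) [MeasurableSpace Ω] (P : MeasureTheory.Measure Ω)
    [MeasureTheory.IsProbabilityMeasure P] (A : Ω → Matrix (Fin n) (Fin m) ℝ),
    IsGaussianMatrix P A → ∀ x : Fin m → ℝ, IsSparse k x →
      p < P.real {ω | Recovers (A ω) x k L}

end AOLS

/-! # Recovery of sparse vectors by accelerated orthogonal least squares

Once the set `S` has been selected, the residual is the projection `r_S` of `y` to the orthogonal
complement of the span of the columns in `S`, the vectors `t_j` are the projections of the columns,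
and `‖q_j‖ = |⟪a_j, r_S⟫| / ‖t_j‖`. The algorithm succeeds if each iteration selects at least one
new index of the support `T` of `x`.

A deterministic lower bound for the scores on `T`: as `r_S` is orthogonal to the columns in `S`,
one has `‖r_S‖² = ∑ x_l ⟪a_l, r_S⟫` over `l ∈ T \ S`, so if `‖x_{T \ S}‖ ≤ 4 ‖r_S‖` and the columns
have length at most `2`, then some `l ∈ T \ S` has a score of at least `‖r_S‖ / (8 √k)`
(`WellBehaved.exists_score_ge`).

For the scores off `T` the difficulty is that, for `L ≥ 2`, columns off the support get selected
too, so `r_S` is not independent of the columns off the support. This is resolved by a leave-one-out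
argument. As long as `j ∉ T` has not been selected, the run agrees with the run in which `j` may
never be selected, whose residuals do not depend on `a_j`. Hence each of these at most `k m` inner
products `⟪a_j, r⟫` is Gaussian given `r`, and all of them are small compared to `‖r‖ / √k` with
high probability if `n` is large compared to `k log m` (`columnLaw_abs_inner_ge`). The comparison of
the two runs is valid if there are no ties, and ties have probability zero (`columnLaw_score_eq`),
since a tie is a nontrivial polynomial equation along a suitable line.

The remaining bounds hold uniformly in the sets `S` with at most `k L` elements: for fixed `S` the
residual `r_S` is the projection of a Gaussian vector independent of the columns in `S`, so
`‖r_S‖²` is a multiple of a chi-squared variable with at least `n / 2` degrees of freedom, and its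
Laplace transform gives a bound that is exponentially small in `n`. A union bound over the at most
`(m + 1) ^ (k L)` sets finishes the proof (`recoversWithProb`).
-/

namespace AOLS

open Finset

/-! ### Projections away from a set of columns -/

section Projection

variable {ι E : Type*} [NormedAddCommGroup E] [InnerProductSpace ℝ E] [FiniteDimensional ℝ E]

/-- The orthogonal projection onto the orthogonal complement of the span of the vectors `a j`,
`j ∈ S`. -/
noncomputable def perp (a : ι → E) (S : Finset ι) : E →L[ℝ] E :=
  (Submodule.span ℝ (a '' S))ᗮ.starProjection

theorem perp_empty (a : ι → E) (v : E) : perp a ∅ v = v := by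
  refine Submodule.starProjection_eq_self_iff.2 ?_
  simp

theorem perp_congr {a b : ι → E} {S : Finset ι} (h : ∀ j ∈ S, a j = b j) :
    perp a S = perp b S := by
  have : a '' S = b '' S := Set.image_congr (by simpa using h)
  simp only [perp, this]

theorem perp_mem (a : ι → E) (S : Finset ι) (v : E) :
    perp a S v ∈ (Submodule.span ℝ (a '' S))ᗮ :=
  Submodule.starProjection_apply_mem _ _

theorem perp_of_mem {a : ι → E} {S : Finset ι} {v : E}
    (hv : v ∈ (Submodule.span ℝ (a '' S))ᗮ) : perp a S v = v :=
  Submodule.starProjection_eq_self_iff.2 hv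

theorem perp_eq_zero_iff {a : ι → E} {S : Finset ι} {v : E} :
    perp a S v = 0 ↔ v ∈ Submodule.span ℝ (a '' S) := by
  rw [perp, Submodule.starProjection_apply_eq_zero_iff, Submodule.orthogonal_orthogonal]

theorem perp_apply_mem {a : ι → E} {S : Finset ι} {j : ι} (hj : j ∈ S) : perp a S (a j) = 0 :=
  perp_eq_zero_iff.2 (Submodule.subset_span ⟨j, by simpa using hj, rfl⟩)

theorem inner_perp_left (a : ι → E) (S : Finset ι) (u v : E) :
    inner ℝ (perp a S u) v = inner ℝ u (perp a S v) :=
  Submodule.inner_starProjection_left_eq_right _ _ _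

theorem perp_perp (a : ι → E) (S : Finset ι) (v : E) : perp a S (perp a S v) = perp a S v :=
  perp_of_mem (perp_mem a S v)

theorem inner_perp_perp (a : ι → E) (S : Finset ι) (u v : E) :
    inner ℝ (perp a S u) (perp a S v) = inner ℝ u (perp a S v) := by
  rw [inner_perp_left, perp_perp]

theorem norm_perp_le (a : ι → E) (S : Finset ι) (v : E) : ‖perp a S v‖ ≤ ‖v‖ :=
  Submodule.norm_starProjection_apply_le _ _

/-- One Gram–Schmidt step. The formula also holds if `a j` lies in the span of the `a l`, `l ∈ S`:
the coefficient is then `0 / 0 = 0`. -/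
theorem perp_insert [DecidableEq ι] (a : ι → E) (S : Finset ι) (j : ι) (v : E) :
    perp a (insert j S) v = perp a S v -
      (inner ℝ (perp a S v) (perp a S (a j)) / ‖perp a S (a j)‖ ^ 2) • perp a S (a j) := by
  set w := perp a S (a j) with hw
  set c := inner ℝ (perp a S v) w / ‖w‖ ^ 2 with hc
  have hle : Submodule.span ℝ (a '' S) ≤ Submodule.span ℝ (a '' (insert j S : Finset ι)) :=
    Submodule.span_mono (Set.image_mono (by simp))
  have hsub : ∀ u, u - perp a S u ∈ Submodule.span ℝ (a '' S) := fun u => by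
    rw [← perp_eq_zero_iff, map_sub, perp_perp, sub_self]
  have hwm : w ∈ Submodule.span ℝ (a '' (insert j S : Finset ι)) := by
    have h1 := hle (hsub (a j))
    have h2 : a j ∈ Submodule.span ℝ (a '' (insert j S : Finset ι)) :=
      Submodule.subset_span ⟨j, by simp, rfl⟩
    simpa using Submodule.sub_mem _ h2 h1
  refine Submodule.eq_starProjection_of_mem_orthogonal ?_ ?_
  · have hS : ∀ u ∈ Submodule.span ℝ (a '' S), inner ℝ (perp a S v - c • w) u = 0 :=
      (Submodule.mem_orthogonal' _ _).1
        (Submodule.sub_mem _ (perp_mem a S v) (Submodule.smul_mem _ _ (perp_mem a S _)))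
    rw [Submodule.mem_orthogonal']
    intro u hu
    refine Submodule.span_induction (p := fun u _ => inner ℝ (perp a S v - c • w) u = 0)
      ?_ (by simp) (fun x y _ _ hx hy => by rw [inner_add_right, hx, hy, add_zero])
      (fun r x _ hx => by rw [inner_smul_right, hx, mul_zero]) hu
    rintro _ ⟨l, hl, rfl⟩
    rcases Finset.mem_insert.1 (Finset.mem_coe.1 hl) with rfl | hl
    · have h3 : inner ℝ (perp a S v - c • w) (a l) = inner ℝ (perp a S v - c • w) w := by
        have := hS _ (hsub (a l))
        rw [inner_sub_right, sub_eq_zero] at this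
        exact this
      rw [h3, inner_sub_left, inner_smul_left, real_inner_self_eq_norm_sq]
      by_cases h0 : w = 0
      · simp [h0]
      · have : ‖w‖ ^ 2 ≠ 0 := by simpa using h0
        simp [hc, div_mul_cancel₀ _ this]
    · exact hS _ (Submodule.subset_span ⟨l, hl, rfl⟩)
  · rw [Submodule.orthogonal_orthogonal]
    have : v - (perp a S v - c • w) = (v - perp a S v) + c • w := by abel
    rw [this]
    exact Submodule.add_mem _ (hle (hsub v)) (Submodule.smul_mem _ _ hwm)

theorem finrank_orthogonal_span_image (a : ι → E) (S : Finset ι) :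
    Module.finrank ℝ E ≤ Module.finrank ℝ (Submodule.span ℝ (a '' S))ᗮ + S.card := by
  have h1 := (Submodule.span ℝ (a '' S)).finrank_add_finrank_orthogonal
  have h2 : Module.finrank ℝ (Submodule.span ℝ (a '' S)) ≤ S.card := by
    classical
    rw [← Finset.coe_image]
    exact (finrank_span_finset_le_card _).trans Finset.card_image_le
  omega

end Projection

/-! ### Residuals, scores and the leave-one-out run -/

section Scores

variable {n m : ℕ}

/-- The combination `∑ j, x j • a j` of the columns `a j`. -/
noncomputable def synth (x : Fin m → ℝ) (a : Fin m → EuclideanSpace ℝ (Fin n)) :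
    EuclideanSpace ℝ (Fin n) :=
  ∑ j, x j • a j

theorem measurements_eq_synth (A : Matrix (Fin n) (Fin m) ℝ) (x : Fin m → ℝ) :
    measurements A x = synth x (column A) := by
  ext i
  simp [measurements, synth, column, Matrix.mulVec, dotProduct, mul_comm]

/-- The residual of `∑ j, x j • a j` after the columns in `S` have been selected. -/
noncomputable def resid (x : Fin m → ℝ) (a : Fin m → EuclideanSpace ℝ (Fin n))
    (S : Finset (Fin m)) : EuclideanSpace ℝ (Fin n) :=
  perp a S (synth x a)

/-- The value `‖q_j‖` by which AOLS ranks the index `j` once `S` has been selected. -/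
noncomputable def score (x : Fin m → ℝ) (a : Fin m → EuclideanSpace ℝ (Fin n))
    (S : Finset (Fin m)) (j : Fin m) : ℝ :=
  |inner ℝ (a j) (resid x a S)| / ‖perp a S (a j)‖

/-- Given a relation `R` (to be read as `score l < score l'`), add to `S` the indices outside
`S ∪ {j}` that are exceeded by fewer than `L` others. -/
noncomputable def addTop (L : ℕ) (j : Fin m) (S : Finset (Fin m)) (R : Fin m → Fin m → Prop) :
    Finset (Fin m) :=
  open Classical in
  S ∪ univ.filter fun l => l ∉ S ∧ l ≠ j ∧
    (univ.filter fun l' => l' ∉ S ∧ l' ≠ j ∧ R l l').card < L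

/-- The set selected in `i` iterations by the run of AOLS that is never allowed to select the
index `j`; if `x j = 0` it depends only on the columns other than `a j`. -/
noncomputable def leaveOneOut (x : Fin m → ℝ) (a : Fin m → EuclideanSpace ℝ (Fin n)) (L : ℕ)
    (j : Fin m) : ℕ → Finset (Fin m)
  | 0 => ∅
  | i + 1 => addTop L j (leaveOneOut x a L j i)
      fun l l' => score x a (leaveOneOut x a L j i) l < score x a (leaveOneOut x a L j i) l'

theorem notMem_leaveOneOut (x : Fin m → ℝ) (a : Fin m → EuclideanSpace ℝ (Fin n)) (L : ℕ)
    (j : Fin m) (i : ℕ) : j ∉ leaveOneOut x a L j i := by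
  induction i with
  | zero => simp [leaveOneOut]
  | succ i ih => simp [leaveOneOut, addTop, ih]

theorem resid_congr {x : Fin m → ℝ} {a b : Fin m → EuclideanSpace ℝ (Fin n)}
    {S : Finset (Fin m)} {j : Fin m} (hx : x j = 0) (hj : j ∉ S) (h : ∀ l ≠ j, a l = b l) :
    resid x a S = resid x b S := by
  have h1 : perp a S = perp b S := perp_congr fun l hl => h l (by rintro rfl; exact hj hl)
  have h2 : synth x a = synth x b := by
    refine Finset.sum_congr rfl fun l _ => ?_
    by_cases hl : l = j
    · simp [hl, hx]
    · rw [h l hl]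
  rw [resid, resid, h1, h2]

theorem leaveOneOut_congr {x : Fin m → ℝ} {a b : Fin m → EuclideanSpace ℝ (Fin n)} (L : ℕ)
    {j : Fin m} (hx : x j = 0) (h : ∀ l ≠ j, a l = b l) (i : ℕ) :
    leaveOneOut x a L j i = leaveOneOut x b L j i := by
  induction i with
  | zero => rfl
  | succ i ih =>
    have hj := notMem_leaveOneOut x b L j i
    have hs : ∀ l ≠ j,
        score x a (leaveOneOut x b L j i) l = score x b (leaveOneOut x b L j i) l := by
      intro l hl
      have h1 : perp a (leaveOneOut x b L j i) = perp b (leaveOneOut x b L j i) :=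
        perp_congr fun l hl => h l (by rintro rfl; exact hj hl)
      rw [score, score, resid_congr hx hj h, h l hl, h1]
    simp only [leaveOneOut, ih, addTop]
    congr 1
    refine Finset.filter_congr fun l _ => ?_
    refine and_congr_right fun _ => and_congr_right fun hl => ?_
    rw [Finset.filter_congr (q := fun l' => l' ∉ leaveOneOut x b L j i ∧ l' ≠ j ∧
      score x b (leaveOneOut x b L j i) l < score x b (leaveOneOut x b L j i) l')]
    intro l' _
    refine and_congr_right fun _ => and_congr_right fun hl' => ?_
    rw [hs l hl, hs l' hl']

/-- If there are no ties, then `L` indices with the largest scores are those that `addTop` adds,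
whatever unselected index `j` it excludes. -/
theorem addTop_eq_union {L : ℕ} {j : Fin m} {S : Finset (Fin m)} {f : Fin m → ℝ}
    {T : Finset (Fin m)} (hT : T.card = L) (hTS : Disjoint T S) (hj : j ∉ T)
    (hmax : ∀ l ∈ T, ∀ l', l' ∉ S → l' ∉ T → f l' < f l) :
    addTop L j S (fun l l' => f l < f l') = S ∪ T := by
  classical
  rw [addTop]
  congr 1
  ext l
  simp only [mem_filter, mem_univ, true_and]
  constructor
  · rintro ⟨hlS, hlj, hcard⟩
    by_contra hlT
    refine absurd hcard (not_lt.2 (hT ▸ Finset.card_le_card fun l' hl' => ?_))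
    simp only [mem_filter, mem_univ, true_and]
    exact ⟨Finset.disjoint_left.1 hTS hl', fun h => hj (h ▸ hl'), hmax l' hl' l hlS hlT⟩
  · intro hl
    refine ⟨Finset.disjoint_left.1 hTS hl, fun h => hj (h ▸ hl), ?_⟩
    rw [← hT]
    refine Finset.card_lt_card ⟨fun l' hl' => ?_, fun h => ?_⟩
    · simp only [mem_filter, mem_univ, true_and] at hl'
      by_contra hT'
      exact lt_asymm hl'.2.2 (hmax l hl l' hl'.1 hT')
    · simpa using h hl

end Scores

/-! ### Recovery for well-behaved columns -/

section Recovery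

variable {n m : ℕ}

/-- The properties of the columns `a` under which AOLS provably recovers `x`. All of them hold
with high probability for Gaussian columns. -/
structure WellBehaved (x : Fin m → ℝ) (a : Fin m → EuclideanSpace ℝ (Fin n)) (k L : ℕ) :
    Prop where
  /-- No column is close to the span of few others. -/
  separated : ∀ S : Finset (Fin m), S.card ≤ k * L → ∀ l ∉ S, 1 / 4 ≤ ‖perp a S (a l)‖
  /-- The residual is bounded below by the part of `x` that is not yet selected. -/
  resid_ge : ∀ S : Finset (Fin m), S.card ≤ k * L →
    1 / 4 * √(∑ l ∈ Sᶜ, x l ^ 2) ≤ ‖resid x a S‖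
  norm_le : ∀ l, ‖a l‖ ≤ 2
  inner_ne_zero : ∀ S : Finset (Fin m), S.card ≤ k * L → ∀ l ∉ S, resid x a S ≠ 0 →
    inner ℝ (a l) (resid x a S) ≠ 0
  /-- There are no ties. -/
  score_ne : ∀ S : Finset (Fin m), S.card ≤ k * L → ∀ l ∉ S, ∀ l' ∉ S, l ≠ l' →
    resid x a S ≠ 0 → score x a S l ≠ score x a S l'
  /-- Columns off the support are nearly orthogonal to the residuals of their leave-one-out
  runs. -/
  inner_lt : ∀ j, x j = 0 → ∀ i < k, resid x a (leaveOneOut x a L j i) ≠ 0 →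
    |inner ℝ (a j) (resid x a (leaveOneOut x a L j i))| <
      ‖resid x a (leaveOneOut x a L j i)‖ / (32 * √k)

theorem resid_eq_zero_of_support_subset {x : Fin m → ℝ}
    {a : Fin m → EuclideanSpace ℝ (Fin n)} {S : Finset (Fin m)} (h : ∀ l ∉ S, x l = 0) :
    resid x a S = 0 := by
  rw [resid, synth, map_sum]
  refine Finset.sum_eq_zero fun l _ => ?_
  rw [map_smul]
  by_cases hl : l ∈ S
  · rw [perp_apply_mem hl, smul_zero]
  · rw [h l hl, zero_smul]

theorem resid_mono {x : Fin m → ℝ} {a : Fin m → EuclideanSpace ℝ (Fin n)}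
    {S T : Finset (Fin m)} (hST : S ⊆ T) (h : resid x a S = 0) : resid x a T = 0 :=
  perp_eq_zero_iff.2 (Submodule.span_mono (Set.image_mono (by simpa using hST))
    (perp_eq_zero_iff.1 h))

theorem resid_insert (x : Fin m → ℝ) (a : Fin m → EuclideanSpace ℝ (Fin n))
    (S : Finset (Fin m)) (j : Fin m) :
    resid x a (insert j S) = resid x a S -
      (inner ℝ (a j) (resid x a S) / ‖perp a S (a j)‖ ^ 2) • perp a S (a j) := by
  rw [resid, perp_insert, real_inner_comm, inner_perp_perp, ← resid]

variable {x : Fin m → ℝ} {k L : ℕ} {a : Fin m → EuclideanSpace ℝ (Fin n)}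

theorem WellBehaved.support_subset (h : WellBehaved x a k L) {S : Finset (Fin m)}
    (hS : S.card ≤ k * L) (h0 : resid x a S = 0) (l : Fin m) (hl : l ∉ S) : x l = 0 := by
  have h1 := h.resid_ge S hS
  rw [h0, norm_zero] at h1
  have h2 : √(∑ l ∈ Sᶜ, x l ^ 2) = 0 := le_antisymm (by linarith) (Real.sqrt_nonneg _)
  rw [Real.sqrt_eq_zero (Finset.sum_nonneg fun _ _ => sq_nonneg _),
    Finset.sum_eq_zero_iff_of_nonneg fun _ _ => sq_nonneg _] at h2
  simpa using h2 l (by simpa using hl)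

/-- As long as the residual does not vanish, some unselected index of the support has a large
score, because `‖r‖² = ∑ x_l ⟪a_l, r⟫` over the unselected indices `l` of the support. -/
theorem WellBehaved.exists_score_ge (h : WellBehaved x a k L) (hx : IsSparse k x)
    {S : Finset (Fin m)} (hS : S.card ≤ k * L) (h0 : resid x a S ≠ 0) :
    ∃ t ∉ S, x t ≠ 0 ∧ ‖resid x a S‖ / (8 * √k) ≤ score x a S t := by
  classical
  set R := resid x a S with hR
  set U : Finset (Fin m) := univ.filter fun l => l ∉ S ∧ x l ≠ 0 with hU
  have hUne : U.Nonempty := by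
    by_contra hne
    refine h0 (resid_eq_zero_of_support_subset fun l hl => ?_)
    by_contra hxl
    exact hne ⟨l, by simp [hU, hl, hxl]⟩
  obtain ⟨t, htU, ht⟩ := Finset.exists_max_image U (score x a S) hUne
  simp only [hU, mem_filter, mem_univ, true_and] at htU
  refine ⟨t, htU.1, htU.2, ?_⟩
  have hcard : U.card ≤ k := by
    refine le_trans ?_ hx
    rw [← Set.ncard_coe_finset]
    exact Set.ncard_le_ncard (fun l hl => by
      have : l ∈ U := hl
      simp only [hU, mem_filter] at this
      exact this.2.2) (Set.toFinite _)
  have hkpos : 0 < k := lt_of_lt_of_le (Finset.card_pos.2 hUne) hcard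
  have hsum : ‖R‖ ^ 2 = ∑ l ∈ U, x l * inner ℝ (a l) R := by
    have h1 : ‖R‖ ^ 2 = ∑ l, x l * inner ℝ (a l) R := by
      rw [← real_inner_self_eq_norm_sq, hR, resid, inner_perp_perp, ← resid]
      nth_rewrite 1 [synth]
      rw [sum_inner]
      simp only [inner_smul_left, RCLike.conj_to_real]
    rw [h1]
    refine (Finset.sum_subset (Finset.subset_univ _) fun l _ hl => ?_).symm
    simp only [hU, mem_filter, mem_univ, true_and, not_and, not_not] at hl
    by_cases hlS : l ∈ S
    · rw [hR, resid, ← inner_perp_perp, perp_apply_mem hlS, inner_zero_left, mul_zero]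
    · rw [hl hlS, zero_mul]
  have hscore : 0 ≤ score x a S t := by unfold score; positivity
  have hterm : ∀ l ∈ U, |inner ℝ (a l) R| ≤ 2 * score x a S t := by
    intro l hl
    have hlS : l ∉ S := by simp only [hU, mem_filter] at hl; exact hl.2.1
    have hpos : 0 < ‖perp a S (a l)‖ := by linarith [h.separated S hS l hlS]
    have h1 : |inner ℝ (a l) R| = score x a S l * ‖perp a S (a l)‖ := by
      rw [score, div_mul_cancel₀ _ hpos.ne']
    rw [h1, mul_comm]
    exact mul_le_mul ((norm_perp_le _ _ _).trans (h.norm_le l)) (ht l hl)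
      (by unfold score; positivity) (by norm_num)
  have hl1 : ∑ l ∈ U, |x l| ≤ √k * (4 * ‖R‖) := by
    have h1 : (∑ l ∈ U, |x l|) ^ 2 ≤ U.card * ∑ l ∈ U, |x l| ^ 2 := sq_sum_le_card_mul_sum_sq
    have h2 : ∑ l ∈ U, |x l| ^ 2 ≤ ∑ l ∈ Sᶜ, x l ^ 2 := by
      simp only [sq_abs]
      refine Finset.sum_le_sum_of_subset_of_nonneg (fun l hl => ?_) fun _ _ _ => sq_nonneg _
      simp only [hU, mem_filter] at hl
      simpa using hl.2.1
    have h3 : √(∑ l ∈ Sᶜ, x l ^ 2) ≤ 4 * ‖R‖ := by linarith [h.resid_ge S hS]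
    refine le_trans ?_ (mul_le_mul_of_nonneg_left h3 (Real.sqrt_nonneg _))
    rw [← Real.sqrt_mul (Nat.cast_nonneg k)]
    refine Real.le_sqrt_of_sq_le (h1.trans ?_)
    exact mul_le_mul (by exact_mod_cast hcard) h2 (Finset.sum_nonneg fun _ _ => sq_nonneg _)
      (Nat.cast_nonneg _)
  have hmain : ‖R‖ ^ 2 ≤ 2 * score x a S t * (√k * (4 * ‖R‖)) := by
    rw [hsum]
    calc ∑ l ∈ U, x l * inner ℝ (a l) R ≤ ∑ l ∈ U, |x l| * (2 * score x a S t) := by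
          refine Finset.sum_le_sum fun l hl => (le_abs_self _).trans ?_
          rw [abs_mul]
          exact mul_le_mul_of_nonneg_left (hterm l hl) (abs_nonneg _)
      _ = 2 * score x a S t * ∑ l ∈ U, |x l| := by rw [← Finset.sum_mul, mul_comm]
      _ ≤ _ := mul_le_mul_of_nonneg_left hl1 (by positivity)
  have hRpos : 0 < ‖R‖ := norm_pos_iff.2 h0
  have hk : 0 < √(k : ℝ) := Real.sqrt_pos.2 (by exact_mod_cast hkpos)
  rw [div_le_iff₀ (by positivity)]
  refine le_of_mul_le_mul_right ?_ hRpos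
  nlinarith [hmain]

/-- What the state of the algorithm is in terms of its set of selected indices. Once the residual
vanishes the vectors `t l` are no longer updated, hence the second condition. -/
structure State.Sound (x : Fin m → ℝ) (A : Matrix (Fin n) (Fin m) ℝ) (σ : State n m) : Prop where
  r_eq : σ.r = resid x (column A) σ.S
  t_eq : σ.r ≠ 0 → ∀ l, σ.t l = perp (column A) σ.S (column A l)

variable {A : Matrix (Fin n) (Fin m) ℝ}

theorem State.sound_init : (State.init A (measurements A x)).Sound x A where
  r_eq := by simp [State.init, resid, perp_empty, measurements_eq_synth]
  t_eq _ l := by simp [State.init, perp_empty]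

theorem State.Sound.q_eq {σ : State n m} (hσ : σ.Sound x A) (hr : σ.r ≠ 0) (j : Fin m) :
    σ.q A j = (inner ℝ (column A j) (resid x (column A) σ.S) /
      ‖perp (column A) σ.S (column A j)‖ ^ 2) • perp (column A) σ.S (column A j) := by
  rw [State.q, hσ.t_eq hr, hσ.r_eq, ← inner_perp_perp _ _ (column A j) (column A j),
    real_inner_self_eq_norm_sq]

theorem State.Sound.norm_q {σ : State n m} (hσ : σ.Sound x A) (hr : σ.r ≠ 0) (j : Fin m) :
    ‖σ.q A j‖ = score x (column A) σ.S j := by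
  rw [hσ.q_eq hr, norm_smul, score, Real.norm_eq_abs, abs_div, abs_of_nonneg (sq_nonneg ‖_‖)]
  by_cases h : ‖perp (column A) σ.S (column A j)‖ = 0
  · simp [h]
  · field_simp

theorem State.Sound.absorb (h : WellBehaved x (column A) k L) {σ : State n m}
    (hσ : σ.Sound x A) {j : Fin m} (hj : j ∉ σ.S) (hS : σ.S.card ≤ k * L) :
    (σ.absorb A j).Sound x A := by
  by_cases hr : σ.r = 0
  · have hq : σ.q A j = 0 := by simp [State.q, hr]
    have h0 : (σ.absorb A j).r = 0 := by simp [State.absorb, hr, hq]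
    refine ⟨?_, fun hne => absurd h0 hne⟩
    rw [h0]
    exact (resid_mono (Finset.subset_insert j σ.S) (hσ.r_eq ▸ hr)).symm
  · refine ⟨?_, fun _ l => ?_⟩
    · simp only [State.absorb]
      rw [resid_insert, hσ.q_eq hr, hσ.r_eq]
    · simp only [State.absorb]
      have hw : ‖perp (column A) σ.S (column A j)‖ ≠ 0 := by
        linarith [h.separated σ.S hS j hj]
      have hc := h.inner_ne_zero σ.S hS j hj (hσ.r_eq ▸ hr)
      rw [perp_insert, hσ.t_eq hr, hσ.q_eq hr]
      congr 1
      rw [inner_smul_right, norm_smul, smul_smul, mul_pow, Real.norm_eq_abs, sq_abs]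
      congr 1
      field_simp

theorem State.Sound.foldl (h : WellBehaved x (column A) k L) (l : List (Fin m)) :
    ∀ {σ : State n m}, σ.Sound x A → l.Nodup → (∀ j ∈ l, j ∉ σ.S) →
      σ.S.card + l.length ≤ k * L →
      (l.foldl (State.absorb A) σ).Sound x A ∧
        (l.foldl (State.absorb A) σ).S = σ.S ∪ l.toFinset := by
  induction l with
  | nil => intro σ hσ _ _ _; simpa using hσ
  | cons j l ih =>
    intro σ hσ hnd hl hcard
    have hj : j ∉ σ.S := hl j (by simp)
    rw [List.nodup_cons] at hnd
    rw [List.length_cons] at hcard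
    have hins : (σ.absorb A j).S = insert j σ.S := rfl
    have := ih (σ := σ.absorb A j) (hσ.absorb h hj (by omega)) hnd.2
      (fun i hi => by
        rw [hins, Finset.mem_insert, not_or]
        exact ⟨fun hij => hnd.1 (hij ▸ hi), hl i (by simp [hi])⟩)
      (by rw [hins, Finset.card_insert_of_notMem hj]; omega)
    refine ⟨this.1, ?_⟩
    rw [List.foldl_cons, this.2, hins]
    ext i
    simp only [mem_union, mem_insert, List.toFinset_cons]
    tauto

/-- The invariant of a run after `i` iterations: as long as `j` has not been selected, the selected
set is that of the leave-one-out run for `j`, and each iteration has found a new index of the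
support. -/
structure State.Progress (x : Fin m → ℝ) (A : Matrix (Fin n) (Fin m) ℝ) (k L i : ℕ)
    (σ : State n m) : Prop where
  sound : σ.Sound x A
  iter_le : i ≤ k
  card_eq : σ.S.card = i * L
  eq_leaveOneOut : ∀ j ∉ σ.S, σ.S = leaveOneOut x (column A) L j i
  le_hits : i ≤ (σ.S.filter fun j => x j ≠ 0).card

/-- An iteration finds a new index of the support: otherwise an index off the support would have a
score of at least `‖r‖ / (8 √k)`, against the bound for its leave-one-out run. -/
theorem State.Progress.step (h : WellBehaved x (column A) k L) (hx : IsSparse k x) (hL : 1 ≤ L)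
    {i : ℕ} {σ : State n m} (hσ : σ.Progress x A k L i) (hr : σ.r ≠ 0) (hi : i < k)
    {l : List (Fin m)} (hl : IsSelection A L σ l) :
    (l.foldl (State.absorb A) σ).Progress x A k L (i + 1) := by
  obtain ⟨hnd, hlen, hnew, hmax⟩ := hl
  have hmul : i * L + L ≤ k * L := by nlinarith
  have hS : σ.S.card ≤ k * L := by rw [hσ.card_eq]; omega
  have hR : resid x (column A) σ.S ≠ 0 := hσ.sound.r_eq ▸ hr
  obtain ⟨hsound, hset⟩ := hσ.sound.foldl h l hnd hnew (by rw [hσ.card_eq, hlen]; exact hmul)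
  have hlcard : l.toFinset.card = L := by rw [List.toFinset_card_of_nodup hnd, hlen]
  have hdisj : Disjoint l.toFinset σ.S :=
    Finset.disjoint_left.2 fun j hj => hnew j (by simpa using hj)
  have hle : ∀ j ∈ l, ∀ j', j' ∉ σ.S → j' ∉ l →
      score x (column A) σ.S j' ≤ score x (column A) σ.S j := by
    intro j hj j' hj' hj'l
    have := hmax j hj j' hj' hj'l
    rwa [hσ.sound.norm_q hr, hσ.sound.norm_q hr] at this
  have hlt : ∀ j ∈ l.toFinset, ∀ j', j' ∉ σ.S → j' ∉ l.toFinset →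
      score x (column A) σ.S j' < score x (column A) σ.S j := by
    intro j hj j' hj' hj'l
    rw [List.mem_toFinset] at hj hj'l
    exact lt_of_le_of_ne (hle j hj j' hj' hj'l)
      (h.score_ne _ hS _ hj' _ (hnew j hj) (fun e => hj'l (e ▸ hj)) hR)
  have hhit : ∃ t ∈ l, x t ≠ 0 := by
    by_contra! hno
    obtain ⟨j, hj⟩ : ∃ j, j ∈ l := List.exists_mem_of_ne_nil l (by rintro rfl; simp at hlen; omega)
    obtain ⟨t, htS, hxt, hts⟩ := h.exists_score_ge hx hS hR
    have h1 := hle j hj t htS fun ht => hxt (hno t ht)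
    have hjS := hnew j hj
    have h2 := h.inner_lt j (hno j hj) i hi
    rw [← hσ.eq_leaveOneOut j hjS] at h2
    have h3 := h.separated σ.S hS j hjS
    have h4 : score x (column A) σ.S j ≤
        4 * |inner ℝ (column A j) (resid x (column A) σ.S)| := by
      rw [score, div_le_iff₀ (by linarith)]
      nlinarith [abs_nonneg (inner ℝ (column A j) (resid x (column A) σ.S))]
    have h5 : ‖resid x (column A) σ.S‖ / (8 * √k) =
        4 * (‖resid x (column A) σ.S‖ / (32 * √k)) := by
      have : √(k : ℝ) ≠ 0 := (Real.sqrt_pos.2 (by exact_mod_cast (by omega : 0 < k))).ne'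
      field_simp; norm_num
    linarith [h2 hR]
  refine ⟨hsound, hi, ?_, ?_, ?_⟩
  · rw [hset, Finset.card_union_of_disjoint hdisj.symm, hσ.card_eq, hlcard]; ring
  · intro j hj
    rw [hset, Finset.mem_union, not_or] at hj
    rw [hset, leaveOneOut, ← hσ.eq_leaveOneOut j hj.1,
      addTop_eq_union hlcard hdisj hj.2 hlt]
  · obtain ⟨t, ht, hxt⟩ := hhit
    rw [hset]
    refine Nat.succ_le_of_lt (lt_of_le_of_lt hσ.le_hits (Finset.card_lt_card ⟨?_, fun hsub => ?_⟩))
    · exact Finset.filter_subset_filter _ Finset.subset_union_left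
    · have : t ∈ (σ.S ∪ l.toFinset).filter fun j => x j ≠ 0 := by simp [ht, hxt]
      exact hnew t ht (Finset.mem_filter.1 (hsub this)).1

theorem Run.progress (h : WellBehaved x (column A) k L) (hx : IsSparse k x) (hL : 1 ≤ L)
    {ε : ℝ} (hε : 0 < ε) {i : ℕ} {σ : State n m} (hσ : Run A (measurements A x) k L ε i σ) :
    σ.Progress x A k L i := by
  induction hσ with
  | start => exact ⟨State.sound_init, Nat.zero_le _, by simp [State.init],
      fun j _ => rfl, Nat.zero_le _⟩
  | step _ hr hi hl ih =>
    exact ih.step h hx hL (norm_pos_iff.1 (hε.trans_le hr)) hi hl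

theorem exists_isSelection (σ : State n m) (h : σ.S.card + L ≤ m) :
    ∃ l, IsSelection A L σ l := by
  classical
  -- the first `L` entries of the unselected indices, sorted by decreasing score
  let r : Fin m → Fin m → Prop := fun i j => ‖σ.q A j‖ ≤ ‖σ.q A i‖
  have hr : ∀ i j, r i j ∨ r j i := fun i j => le_total _ _
  have hrt : ∀ i j l, r i j → r j l → r i l := fun i j l h1 h2 => le_trans h2 h1
  set s := (σ.S)ᶜ.toList.mergeSort (fun i j => decide (r i j)) with hs
  have hperm : s.Perm (σ.S)ᶜ.toList := List.mergeSort_perm _ _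
  have hsorted : s.Pairwise r := by
    have := List.pairwise_mergeSort (le := fun i j => decide (r i j))
      (by simpa using fun i j l => hrt i j l) (by simpa using hr) (σ.S)ᶜ.toList
    simpa using this
  have hnd : s.Nodup := hperm.nodup_iff.2 (Finset.nodup_toList _)
  have hlen : L ≤ s.length := by
    rw [hperm.length_eq, Finset.length_toList, Finset.card_compl, Fintype.card_fin]; omega
  have hmem : ∀ j, j ∈ s ↔ j ∉ σ.S := fun j => by rw [hperm.mem_iff]; simp
  refine ⟨s.take L, hnd.sublist (List.take_sublist _ _), by simpa using hlen,
    fun j hj => (hmem j).1 (List.mem_of_mem_take hj), fun j hj j' hj' hj'l => ?_⟩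
  have h1 : j' ∈ s.drop L := by
    have := (hmem j').2 hj'
    rw [← List.take_append_drop L s, List.mem_append] at this
    exact this.resolve_left hj'l
  rw [← List.take_append_drop L s, List.pairwise_append] at hsorted
  exact hsorted.2.2 j hj j' h1

theorem exists_terminates (h : WellBehaved x (column A) k L) (hx : IsSparse k x) (hL : 1 ≤ L)
    (hm : k * L ≤ m) {ε : ℝ} (hε : 0 < ε) :
    ∃ i σ, Terminates A (measurements A x) k L ε i σ := by
  by_contra! hno
  have hrun : ∀ i ≤ k, ∃ σ, Run A (measurements A x) k L ε i σ := by
    intro i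
    induction i with
    | zero => exact fun _ => ⟨_, Run.start⟩
    | succ i ih =>
      intro hi
      obtain ⟨σ, hσ⟩ := ih (by omega)
      have hgo : ε ≤ ‖σ.r‖ ∧ i < k := by
        by_contra hend
        exact hno i σ ⟨hσ, hend⟩
      have hc := (hσ.progress h hx hL hε).card_eq
      obtain ⟨l, hl⟩ := exists_isSelection (A := A) (L := L) σ (by rw [hc]; nlinarith)
      exact ⟨_, Run.step hσ hgo.1 hgo.2 hl⟩
  obtain ⟨σ, hσ⟩ := hrun k le_rfl
  exact hno k σ ⟨hσ, fun hc => lt_irrefl _ hc.2⟩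

/-- If the columns in `S` are linearly independent and `S` contains the support of `x`, then the
least-squares estimate on `S` is `x`. -/
theorem WellBehaved.estimate_eq (h : WellBehaved x (column A) k L) {S : Finset (Fin m)}
    (hS : S.card ≤ k * L) (hsupp : ∀ l ∉ S, x l = 0) :
    estimate A (measurements A x) S = x := by
  classical
  set B := columnsOf A S with hB
  have hker : ∀ c : S → ℝ, B.mulVec c = 0 → c = 0 := by
    intro c hc
    by_contra hne
    obtain ⟨j, hj⟩ := Function.ne_iff.1 hne
    have hsum : ∑ l : S, c l • column A l = 0 := by
      ext i
      have := congrFun hc i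
      simpa [B, columnsOf, Matrix.mulVec, dotProduct, column, mul_comm] using this
    have h1 := h.separated (S.erase j) ((Finset.card_le_card (Finset.erase_subset _ _)).trans hS)
      j (by simp)
    have h2 : c j • perp (column A) (S.erase j) (column A j) = 0 := by
      have := congrArg (perp (column A) (S.erase j)) hsum
      rw [map_sum, map_zero, Finset.sum_eq_single j] at this
      · simpa using this
      · intro l _ hlj
        rw [map_smul, perp_apply_mem, smul_zero]
        simp [Subtype.coe_injective.ne hlj]
      · simp
    rcases smul_eq_zero.1 h2 with h3 | h3
    · exact hj (by simpa using h3)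
    · rw [h3, norm_zero] at h1; norm_num at h1
  have hunit : IsUnit (B.transpose * B) := by
    rw [← Matrix.mulVec_injective_iff_isUnit]
    refine (injective_iff_map_eq_zero (Matrix.mulVecLin (B.transpose * B))).2 fun c hc => ?_
    have : c ∈ LinearMap.ker (B.transpose * B).mulVecLin := hc
    rw [Matrix.ker_mulVecLin_transpose_mul_self] at this
    exact hker c this
  have hy : (fun i => measurements A x i) = B.mulVec fun l : S => x l := by
    ext i
    simp only [measurements, B, columnsOf, Matrix.mulVec, dotProduct, Matrix.submatrix_apply, id]
    rw [Finset.sum_coe_sort S (fun l => A i l * x l)]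
    exact (Finset.sum_subset (Finset.subset_univ S) fun l _ hl => by rw [hsupp l hl, mul_zero]).symm
  ext j
  rw [estimate]
  split_ifs with hj
  · rw [← hB, hy, Matrix.mulVec_mulVec, Matrix.mul_assoc,
      Matrix.nonsing_inv_mul _ ((Matrix.isUnit_iff_isUnit_det _).1 hunit), Matrix.one_mulVec]
  · exact (hsupp j hj).symm

/-- The deterministic part of the argument: AOLS recovers `x` if the columns are well behaved. -/
theorem WellBehaved.recovers (h : WellBehaved x (column A) k L) (hx : IsSparse k x) (hL : 1 ≤ L)
    (hm : k * L ≤ m) : Recovers A x k L := by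
  classical
  -- a threshold below all nonzero residuals cannot stop the algorithm too early
  obtain ⟨ε₀, hε₀, hmin⟩ : ∃ ε₀ > 0, ∀ S, resid x (column A) S ≠ 0 →
      ε₀ < ‖resid x (column A) S‖ := by
    by_cases hne : (univ.filter fun S => resid x (column A) S ≠ 0).Nonempty
    · obtain ⟨S₀, hS₀, hle⟩ := Finset.exists_min_image _
        (fun S => ‖resid x (column A) S‖) hne
      have hpos : 0 < ‖resid x (column A) S₀‖ := norm_pos_iff.2 (Finset.mem_filter.1 hS₀).2
      refine ⟨_, half_pos hpos, fun S hS => ?_⟩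
      have := hle S (by simpa using hS)
      linarith
    · refine ⟨1, one_pos, fun S hS => absurd ⟨S, ?_⟩ hne⟩
      simpa using hS
  refine ⟨ε₀, hε₀, fun ε hε hεε₀ => ⟨exists_terminates h hx hL hm hε, fun i σ hσ => ?_⟩⟩
  have hp := hσ.1.progress h hx hL hε
  have hcard : σ.S.card ≤ k * L := by
    rw [hp.card_eq]; exact Nat.mul_le_mul_right L hp.iter_le
  refine ⟨hp.iter_le, h.estimate_eq hcard ?_⟩
  by_cases hr : σ.r = 0
  · exact h.support_subset hcard (hp.sound.r_eq ▸ hr)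
  · have hbig : ε ≤ ‖σ.r‖ := by
      have := hmin σ.S (hp.sound.r_eq ▸ hr)
      rw [hp.sound.r_eq]; linarith
    have hik : i = k := le_antisymm hp.iter_le (not_lt.1 fun hi => hσ.2 ⟨hbig, hi⟩)
    -- all `k` iterations have hit the support, so it is exhausted
    have hsupp : (univ.filter fun j => x j ≠ 0).card ≤ k := by
      refine le_trans (le_of_eq ?_) hx
      rw [← Set.ncard_coe_finset]; simp
    have heq : (σ.S.filter fun j => x j ≠ 0) = univ.filter fun j => x j ≠ 0 :=
      Finset.eq_of_subset_of_card_le (Finset.filter_subset_filter _ (Finset.subset_univ _))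
        (hsupp.trans (hik ▸ hp.le_hits))
    intro l hl
    by_contra hxl
    have : l ∈ σ.S.filter fun j => x j ≠ 0 := by rw [heq]; simp [hxl]
    exact hl (Finset.mem_filter.1 this).1

end Recovery

/-! ### Gaussian vectors -/

section Gaussian

open MeasureTheory ProbabilityTheory

theorem integrable_exp_mul_sq_gaussianReal {s : ℝ} (hs : s < 1 / 2) :
    Integrable (fun ξ => Real.exp (s * ξ ^ 2)) (gaussianReal 0 1) := by
  rw [gaussianReal_of_var_ne_zero _ one_ne_zero,
    integrable_withDensity_iff (measurable_gaussianPDF 0 1) (by simp [gaussianPDF])]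
  refine ((integrable_exp_neg_mul_sq (b := 1 / 2 - s) (by linarith)).const_mul
    (√(2 * Real.pi))⁻¹).congr (Filter.Eventually.of_forall fun ξ => ?_)
  simp only [toReal_gaussianPDF, gaussianPDFReal, NNReal.coe_one, mul_one, sub_zero]
  rw [mul_left_comm, ← Real.exp_add]
  congr 2
  ring

theorem integral_exp_mul_sq_gaussianReal {s : ℝ} (hs : s < 1 / 2) :
    ∫ ξ, Real.exp (s * ξ ^ 2) ∂gaussianReal 0 1 = √(1 / (1 - 2 * s)) := by
  rw [integral_gaussianReal_eq_integral_smul one_ne_zero]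
  have : ∀ ξ : ℝ, gaussianPDFReal 0 1 ξ • Real.exp (s * ξ ^ 2) =
      (√(2 * Real.pi))⁻¹ * Real.exp (-(1 / 2 - s) * ξ ^ 2) := by
    intro ξ
    simp only [gaussianPDFReal, smul_eq_mul, NNReal.coe_one, mul_one, sub_zero]
    rw [mul_assoc, ← Real.exp_add]
    congr 2
    ring
  simp_rw [this]
  rw [integral_const_mul, integral_gaussian, ← Real.sqrt_inv, ← Real.sqrt_mul (by positivity)]
  congr 1
  have h1 : 1 / 2 - s ≠ 0 := by linarith
  have h2 : 1 - 2 * s ≠ 0 := by linarith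
  have := Real.pi_ne_zero
  field_simp

variable {E : Type*} [NormedAddCommGroup E] [InnerProductSpace ℝ E] [FiniteDimensional ℝ E]
  [MeasurableSpace E] [BorelSpace E]

theorem integrable_integral_exp_mul_norm_sq {s : ℝ} (hs : s < 1 / 2) :
    Integrable (fun v : E => Real.exp (s * ‖v‖ ^ 2)) (stdGaussian E) ∧
    ∫ v, Real.exp (s * ‖v‖ ^ 2) ∂stdGaussian E =
      √(1 / (1 - 2 * s)) ^ Module.finrank ℝ E := by
  have hm : Measurable fun x : Fin (Module.finrank ℝ E) → ℝ =>
      ∑ i, x i • stdOrthonormalBasis ℝ E i := by fun_prop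
  have hexp : ∀ x : Fin (Module.finrank ℝ E) → ℝ,
      Real.exp (s * ‖∑ i, x i • stdOrthonormalBasis ℝ E i‖ ^ 2) =
        ∏ i, Real.exp (s * x i ^ 2) := by
    intro x
    rw [← real_inner_self_eq_norm_sq, (stdOrthonormalBasis ℝ E).orthonormal.inner_sum,
      Finset.mul_sum, Real.exp_sum]
    simp [sq]
  constructor
  · rw [stdGaussian, integrable_map_measure (by fun_prop) hm.aemeasurable]
    simp only [Function.comp_def, hexp]
    exact Integrable.fintype_prod fun _ => integrable_exp_mul_sq_gaussianReal hs
  · rw [stdGaussian, integral_map hm.aemeasurable (by fun_prop)]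
    simp_rw [hexp]
    rw [integral_fintype_prod_eq_pow (fun ξ : ℝ => Real.exp (s * ξ ^ 2)),
      integral_exp_mul_sq_gaussianReal hs, Fintype.card_fin]

theorem stdGaussian_map_orthogonalProjectionOnto (V : Submodule ℝ E) :
    (stdGaussian E).map V.orthogonalProjectionOnto = stdGaussian V := by
  have : IsProbabilityMeasure ((stdGaussian E).map V.orthogonalProjectionOnto) :=
    Measure.isProbabilityMeasure_map (by fun_prop)
  refine Measure.ext_of_charFun (funext fun t => ?_)
  rw [charFun_stdGaussian, charFun_apply, integral_map (by fun_prop) (by fun_prop)]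
  have : ∀ x : E, inner ℝ (V.orthogonalProjectionOnto x) t = inner ℝ x (t : E) := by
    intro x
    simp
  simp_rw [this]
  rw [← charFun_apply, charFun_stdGaussian, Submodule.norm_coe]

/-- The Laplace transform of the squared length of the projection of a standard Gaussian vector
to `V`, a chi-squared variable with `dim V` degrees of freedom. -/
theorem integrable_integral_exp_mul_norm_starProjection_sq (V : Submodule ℝ E) {s : ℝ}
    (hs : s < 1 / 2) :
    Integrable (fun v : E => Real.exp (s * ‖V.starProjection v‖ ^ 2)) (stdGaussian E) ∧
    ∫ v, Real.exp (s * ‖V.starProjection v‖ ^ 2) ∂stdGaussian E =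
      √(1 / (1 - 2 * s)) ^ Module.finrank ℝ V := by
  have h := integrable_integral_exp_mul_norm_sq (E := V) hs
  rw [← stdGaussian_map_orthogonalProjectionOnto,
    integrable_map_measure (by fun_prop) (by fun_prop), integral_map (by fun_prop) (by fun_prop)]
    at h
  exact h

/-- The Chernoff bound for the squared length of the projection of a standard Gaussian vector. -/
theorem measureReal_norm_starProjection_sq_ge (V : Submodule ℝ E) {s : ℝ} (hs : s < 1 / 2)
    (u : ℝ) :
    (stdGaussian E).real {v | u ≤ s * ‖V.starProjection v‖ ^ 2} ≤
      Real.exp (-u) * √(1 / (1 - 2 * s)) ^ Module.finrank ℝ V := by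
  obtain ⟨h1, h2⟩ := integrable_integral_exp_mul_norm_starProjection_sq V hs
  have := mul_meas_ge_le_integral_of_nonneg
    (Filter.Eventually.of_forall fun v => (Real.exp_pos _).le) h1 (Real.exp u)
  rw [h2] at this
  simp only [Real.exp_le_exp] at this
  rw [Real.exp_neg, inv_mul_eq_div, le_div_iff₀ (Real.exp_pos u), mul_comm]
  exact this

variable (E) in
/-- The centred Gaussian measure on `E` with covariance `c ^ 2` times the identity. -/
noncomputable def scaledGaussian (c : ℝ) : Measure E := (stdGaussian E).map (c • ·)

instance (c : ℝ) : IsProbabilityMeasure (scaledGaussian E c) :=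
  Measure.isProbabilityMeasure_map (by fun_prop)

theorem charFun_scaledGaussian (c : ℝ) (t : E) :
    charFun (scaledGaussian E c) t = Complex.exp (-(c ^ 2 * ‖t‖ ^ 2) / 2) := by
  rw [scaledGaussian, charFun_map_smul, charFun_stdGaussian, norm_smul]
  push_cast
  rw [mul_pow, ← Complex.ofReal_pow ‖c‖, Real.norm_eq_abs, sq_abs]
  push_cast
  rfl

theorem scaledGaussian_real_apply (c : ℝ) {B : Set E} (hB : MeasurableSet B) :
    (scaledGaussian E c).real B = (stdGaussian E).real {v | c • v ∈ B} := by
  rw [scaledGaussian, map_measureReal_apply (by fun_prop) hB]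
  rfl

/-- A Gaussian vector is unlikely to be shortened much by a projection whose rank is at least
half the dimension. -/
theorem scaledGaussian_norm_starProjection_lt (V : Submodule ℝ E) {n : ℕ} (hn : 0 < n)
    (hV : n ≤ 2 * Module.finrank ℝ V) {ρ : ℝ} (hρ : 0 < ρ) :
    (scaledGaussian E (ρ / √n)).real {v | ‖V.starProjection v‖ < 1 / 4 * ρ} ≤
      Real.exp (-n / 8) := by
  have hn' : (0 : ℝ) < n := by exact_mod_cast hn
  rw [scaledGaussian_real_apply _ (measurableSet_lt (by fun_prop) (by fun_prop))]
  refine (measureReal_mono ?_).trans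
    ((measureReal_norm_starProjection_sq_ge V (s := -(3 / 2)) (by norm_num) (-(3 / 32) * n)).trans
      ?_)
  · intro v hv
    simp only [Set.mem_ofPred_eq, map_smul, norm_smul, Real.norm_eq_abs] at hv ⊢
    rw [abs_of_pos (by positivity), div_mul_eq_mul_div, div_lt_iff₀ (by positivity)] at hv
    have h1 : ‖V.starProjection v‖ ≤ 1 / 4 * √n := by
      refine le_of_mul_le_mul_left ?_ hρ
      linarith
    have h2 : ‖V.starProjection v‖ ^ 2 ≤ (1 / 4 * √n) ^ 2 := by gcongr
    rw [mul_pow, Real.sq_sqrt hn'.le] at h2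
    linarith
  · have h1 : √(1 / (1 - 2 * -(3 / 2 : ℝ))) = 1 / 2 := by
      rw [show 1 / (1 - 2 * -(3 / 2 : ℝ)) = (1 / 2) ^ 2 by norm_num, Real.sqrt_sq (by norm_num)]
    rw [h1]
    have h2 : (1 / 2 : ℝ) = Real.exp (-Real.log 2) := by
      rw [Real.exp_neg, Real.exp_log (by norm_num)]; norm_num
    rw [h2, ← Real.exp_nat_mul, ← Real.exp_add, Real.exp_le_exp]
    have h3 : (n : ℝ) ≤ 2 * Module.finrank ℝ V := by exact_mod_cast hV
    have h4 := Real.log_two_gt_d9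
    nlinarith

/-- A Gaussian vector is unlikely to be much longer than expected. -/
theorem scaledGaussian_norm_gt {n : ℕ} (hn : 0 < n) (hE : Module.finrank ℝ E = n) :
    (scaledGaussian E (1 / √n)).real {v | 2 < ‖v‖} ≤ Real.exp (-n / 8) := by
  have hn' : (0 : ℝ) < n := by exact_mod_cast hn
  rw [scaledGaussian_real_apply _ (measurableSet_lt (by fun_prop) (by fun_prop))]
  refine (measureReal_mono ?_).trans
    ((measureReal_norm_starProjection_sq_ge (⊤ : Submodule ℝ E) (s := 3 / 8) (by norm_num)
      (3 / 2 * n)).trans ?_)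
  · intro v hv
    have hv' : (⊤ : Submodule ℝ E).starProjection v = v :=
      Submodule.starProjection_eq_self_iff.2 trivial
    simp only [Set.mem_ofPred_eq, norm_smul, Real.norm_eq_abs, hv'] at hv ⊢
    rw [abs_of_pos (by positivity), div_mul_eq_mul_div, lt_div_iff₀ (by positivity), one_mul] at hv
    have h2 : (2 * √n) ^ 2 ≤ ‖v‖ ^ 2 := by gcongr
    rw [mul_pow, Real.sq_sqrt hn'.le] at h2
    linarith
  · have h1 : √(1 / (1 - 2 * (3 / 8 : ℝ))) = 2 := by
      rw [show 1 / (1 - 2 * (3 / 8 : ℝ)) = 2 ^ 2 by norm_num, Real.sqrt_sq (by norm_num)]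
    rw [h1, finrank_top, hE]
    have h2 : (2 : ℝ) = Real.exp (Real.log 2) := (Real.exp_log (by norm_num)).symm
    nth_rewrite 2 [h2]
    rw [← Real.exp_nat_mul, ← Real.exp_add, Real.exp_le_exp]
    have h4 := Real.log_two_lt_d9
    nlinarith

theorem scaledGaussian_abs_inner_ge {n : ℕ} (hn : 0 < n) {w : E} (hw : w ≠ 0) {τ : ℝ}
    (hτ : 0 ≤ τ) :
    (scaledGaussian E (1 / √n)).real {v | ‖w‖ * τ ≤ |inner ℝ v w|} ≤
      2 * Real.exp (-(3 / 8 * (n * τ ^ 2))) := by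
  have hn' : (0 : ℝ) < n := by exact_mod_cast hn
  have hw' : 0 < ‖w‖ := norm_pos_iff.2 hw
  rw [scaledGaussian_real_apply _ (measurableSet_le (by fun_prop) (by fun_prop))]
  refine (measureReal_mono ?_).trans
    ((measureReal_norm_starProjection_sq_ge (ℝ ∙ w) (s := 3 / 8) (by norm_num)
      (3 / 8 * (n * τ ^ 2))).trans ?_)
  · intro v hv
    simp only [Set.mem_ofPred_eq, inner_smul_left, RCLike.conj_to_real, abs_mul] at hv ⊢
    rw [abs_of_pos (by positivity), div_mul_eq_mul_div, le_div_iff₀ (by positivity), one_mul] at hv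
    rw [Submodule.starProjection_singleton, norm_smul, Real.norm_eq_abs]
    have h1 : √n * τ ≤ |inner ℝ w v / ((‖w‖ : ℝ) ^ 2)| * ‖w‖ := by
      rw [abs_div, abs_of_pos (by positivity : 0 < ‖w‖ ^ 2), div_mul_eq_mul_div,
        le_div_iff₀ (by positivity), real_inner_comm]
      nlinarith
    have h2 : (√n * τ) ^ 2 ≤ (|inner ℝ w v / ((‖w‖ : ℝ) ^ 2)| * ‖w‖) ^ 2 := by gcongr
    rw [mul_pow, Real.sq_sqrt hn'.le] at h2
    exact mul_le_mul_of_nonneg_left h2 (by norm_num)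
  · have h1 : √(1 / (1 - 2 * (3 / 8 : ℝ))) = 2 := by
      rw [show 1 / (1 - 2 * (3 / 8 : ℝ)) = 2 ^ 2 by norm_num, Real.sqrt_sq (by norm_num)]
    rw [h1, finrank_span_singleton hw, pow_one, mul_comm]

/-- A set that meets all lines in a given direction in finite sets is null for a Gaussian
measure, because a Gaussian vector is the sum of independent Gaussian vectors in and orthogonal to
this direction. -/
theorem scaledGaussian_eq_zero_of_finite {c : ℝ} (hc : c ≠ 0) {B : Set E} (hB : MeasurableSet B)
    {d : E} (hd : d ≠ 0) (h : ∀ v, {s : ℝ | v + s • d ∈ B}.Finite) :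
    scaledGaussian E c B = 0 := by
  set μ₁ : Measure E := (scaledGaussian E c).map (ℝ ∙ d)ᗮ.starProjection with hμ₁
  set μ₂ : Measure E := (gaussianReal 0 1).map (fun s => s • (c * ‖d‖⁻¹) • d) with hμ₂
  have hd' : ‖d‖ ≠ 0 := by simpa using hd
  have : IsProbabilityMeasure μ₁ := Measure.isProbabilityMeasure_map (by fun_prop)
  have : IsProbabilityMeasure μ₂ := Measure.isProbabilityMeasure_map (by fun_prop)
  have hconv : scaledGaussian E c = μ₁ ∗ μ₂ := by
    refine Measure.ext_of_charFun (funext fun t => ?_)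
    have h1 : charFun μ₁ t = charFun (scaledGaussian E c) ((ℝ ∙ d)ᗮ.starProjection t) := by
      rw [charFun_apply, charFun_apply, hμ₁, integral_map (by fun_prop) (by fun_prop)]
      simp_rw [Submodule.inner_starProjection_left_eq_right]
    have h2 : charFun μ₂ t = charFun (gaussianReal 0 1) (inner ℝ ((c * ‖d‖⁻¹) • d) t) := by
      rw [charFun_apply, charFun_apply_real, hμ₂, integral_map (by fun_prop) (by fun_prop)]
      simp only [inner_smul_left, RCLike.conj_to_real]
      congr 1 with s
      push_cast
      ring_nf
    rw [charFun_conv, h1, h2, charFun_gaussianReal, charFun_scaledGaussian,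
      charFun_scaledGaussian, ← Complex.exp_add]
    congr 1
    have h3 : ‖t‖ ^ 2 = ‖(ℝ ∙ d)ᗮ.starProjection t‖ ^ 2 + (inner ℝ d t / ‖d‖) ^ 2 := by
      rw [(ℝ ∙ d).norm_sq_eq_add_norm_sq_starProjection t, add_comm,
        Submodule.starProjection_singleton, norm_smul, Real.norm_eq_abs, mul_pow, sq_abs]
      congr 1
      simp only [RCLike.ofReal_real_eq_id, id]
      field_simp
    rw [← Complex.ofReal_pow ‖t‖, h3, inner_smul_left]
    simp only [RCLike.conj_to_real]
    push_cast
    ring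
  have hadd : MeasurableSet ((fun x : E × E => x.1 + x.2) ⁻¹' B) := measurable_add hB
  rw [hconv, Measure.conv, Measure.map_apply (by fun_prop) hB, Measure.measure_prod_null hadd]
  refine Filter.Eventually.of_forall fun v => ?_
  simp only [Pi.zero_apply, hμ₂]
  rw [Measure.map_apply (by fun_prop) (measurable_prodMk_left hadd)]
  have : NullSingletonClass (gaussianReal 0 1) := nullSingletonClass_gaussianReal one_ne_zero
  refine Set.Finite.measure_zero ?_ _
  have hinj : Function.Injective fun s : ℝ => s * (c * ‖d‖⁻¹) :=
    mul_left_injective₀ (mul_ne_zero hc (inv_ne_zero hd'))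
  refine ((h v).preimage hinj.injOn).subset fun s hs => ?_
  simpa [smul_smul, mul_assoc] using hs

end Gaussian

/-! ### Measurability -/

section Measurability

open MeasureTheory

theorem measurable_perp {Ω ι E : Type*} [MeasurableSpace Ω] [NormedAddCommGroup E]
    [InnerProductSpace ℝ E] [FiniteDimensional ℝ E] [MeasurableSpace E] [BorelSpace E]
    {a : Ω → ι → E} (ha : ∀ j, Measurable fun ω => a ω j) (S : Finset ι) {v : Ω → E}
    (hv : Measurable v) : Measurable fun ω => perp (a ω) S (v ω) := by
  classical
  induction S using Finset.induction_on generalizing v with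
  | empty => simpa [perp_empty] using hv
  | insert j S _ ih =>
    simp only [perp_insert]
    have h1 := ih hv
    have h2 := ih (ha j)
    fun_prop

variable {n m : ℕ} {Ω : Type*} [MeasurableSpace Ω] {a : Ω → Fin m → EuclideanSpace ℝ (Fin n)}

theorem measurable_synth (ha : ∀ j, Measurable fun ω => a ω j) (x : Fin m → ℝ) :
    Measurable fun ω => synth x (a ω) := by
  unfold synth
  fun_prop

theorem measurable_resid (ha : ∀ j, Measurable fun ω => a ω j) (x : Fin m → ℝ)
    (S : Finset (Fin m)) : Measurable fun ω => resid x (a ω) S :=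
  measurable_perp ha S (measurable_synth ha x)

theorem measurable_score (ha : ∀ j, Measurable fun ω => a ω j) (x : Fin m → ℝ)
    (S : Finset (Fin m)) (j : Fin m) : Measurable fun ω => score x (a ω) S j := by
  unfold score
  have h1 := measurable_resid ha x S
  have h2 := measurable_perp ha S (ha j)
  have h3 := (ha j).inner (𝕜 := ℝ) h1
  have h4 : Measurable fun ω => |inner ℝ (a ω j) (resid x (a ω) S)| := by
    simpa [Real.norm_eq_abs] using h3.norm
  exact h4.div h2.norm

theorem measurableSet_leaveOneOut_eq (ha : ∀ j, Measurable fun ω => a ω j) (x : Fin m → ℝ)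
    (L : ℕ) (j : Fin m) (i : ℕ) (S : Finset (Fin m)) :
    MeasurableSet {ω | leaveOneOut x (a ω) L j i = S} := by
  induction i generalizing S with
  | zero => simp [leaveOneOut]
  | succ i ih =>
    have : {ω | leaveOneOut x (a ω) L j (i + 1) = S} = ⋃ T : Finset (Fin m),
        {ω | leaveOneOut x (a ω) L j i = T} ∩
          (fun ω (l l' : Fin m) => score x (a ω) T l < score x (a ω) T l') ⁻¹'
            {R | addTop L j T R = S} := by
      ext ω
      simp [leaveOneOut]
    rw [this]
    refine MeasurableSet.iUnion fun T => (ih T).inter ?_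
    -- the next set depends on the columns only through finitely many comparisons
    have hm : Measurable fun ω (l l' : Fin m) => score x (a ω) T l < score x (a ω) T l' :=
      measurable_pi_lambda _ fun l => measurable_pi_lambda _ fun l' =>
        measurableSet_setOfPred.1
          (measurableSet_lt (measurable_score ha x T l) (measurable_score ha x T l'))
    exact hm (Set.toFinite _).measurableSet

end Measurability

/-! ### Independent Gaussian columns -/

section Columns

open MeasureTheory ProbabilityTheory

variable {n m : ℕ}

/-- The law of the sequence of columns of a Gaussian matrix. -/
noncomputable def columnLaw (n m : ℕ) : Measure (Fin m → EuclideanSpace ℝ (Fin n)) :=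
  Measure.pi fun _ => scaledGaussian (EuclideanSpace ℝ (Fin n)) (1 / √n)

instance : IsProbabilityMeasure (columnLaw n m) := by unfold columnLaw; infer_instance

theorem map_pi_gaussianReal (n : ℕ) :
    (Measure.pi fun _ : Fin n => gaussianReal 0 (n : NNReal)⁻¹).map (WithLp.toLp 2) =
      scaledGaussian (EuclideanSpace ℝ (Fin n)) (1 / √n) := by
  have : IsProbabilityMeasure
      ((Measure.pi fun _ : Fin n => gaussianReal 0 (n : NNReal)⁻¹).map (WithLp.toLp 2)) :=
    Measure.isProbabilityMeasure_map (by fun_prop)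
  refine Measure.ext_of_charFun (E := EuclideanSpace ℝ (Fin n)) (funext fun t => ?_)
  simp_rw [charFun_scaledGaussian, charFun_pi, charFun_gaussianReal, ← Complex.exp_sum,
    ← Complex.ofReal_pow, EuclideanSpace.real_norm_sq_eq]
  congr 1
  rw [div_pow, Real.sq_sqrt (Nat.cast_nonneg n)]
  push_cast
  simp [Finset.mul_sum, Finset.sum_div, neg_div]

theorem hasLaw_column {Ω : Type*} [MeasurableSpace Ω] {P : Measure Ω} [IsProbabilityMeasure P]
    {A : Ω → Matrix (Fin n) (Fin m) ℝ} (hA : IsGaussianMatrix P A) :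
    HasLaw (fun ω => column (A ω)) (columnLaw n m) P := by
  have hind : iIndepFun (fun (ji : Fin m × Fin n) ω => A ω ji.2 ji.1) P :=
    hA.2.precomp (g := Prod.swap) Prod.swap_injective
  have h1 := hind.hasLaw_pi (μ := fun _ => gaussianReal 0 (n : NNReal)⁻¹)
    fun ji : Fin m × Fin n => hA.1 ji.2 ji.1
  have h2 : MeasurePreserving (MeasurableEquiv.curry (Fin m) (Fin n) ℝ)
      (Measure.pi fun _ => gaussianReal 0 (n : NNReal)⁻¹)
      (Measure.pi fun _ => Measure.pi fun _ => gaussianReal 0 (n : NNReal)⁻¹) := by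
    refine ⟨by fun_prop, ?_⟩
    have := Measure.infinitePi_map_curry
      fun (_ : Fin m) (_ : Fin n) => gaussianReal 0 (n : NNReal)⁻¹
    simpa only [Measure.infinitePi_eq_pi] using this
  have h3 : MeasurePreserving (fun (f : Fin m → Fin n → ℝ) j => WithLp.toLp 2 (f j))
      (Measure.pi fun _ => Measure.pi fun _ => gaussianReal 0 (n : NNReal)⁻¹)
      (columnLaw n m) := by
    refine measurePreserving_pi _ _ fun _ => ⟨by fun_prop, map_pi_gaussianReal n⟩
  exact (h3.comp h2).comp_hasLaw h1

/-- Conditioning on the columns outside `U`: a combination of the columns in `U` is a Gaussian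
vector independent of them. The columns in `U` are replaced by `0` on the right. -/
theorem columnLaw_real_le (U : Finset (Fin m)) (z : Fin m → ℝ)
    {B : Set (EuclideanSpace ℝ (Fin n) × (Fin m → EuclideanSpace ℝ (Fin n)))}
    (hB : MeasurableSet B) {p : ℝ}
    (hp : ∀ b, (scaledGaussian (EuclideanSpace ℝ (Fin n)) (√(∑ l ∈ U, z l ^ 2) / √n)).real
      {v | (v, b) ∈ B} ≤ p) :
    (columnLaw n m).real
      {a | (∑ l ∈ U, z l • a l, fun l => if l ∈ U then 0 else a l) ∈ B} ≤ p := by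
  set X : Fin m → (Fin m → EuclideanSpace ℝ (Fin n)) → EuclideanSpace ℝ (Fin n) :=
    fun j a => a j with hX
  have hXm : ∀ j, Measurable (X j) := fun j => measurable_pi_apply j
  have hind : iIndepFun X (columnLaw n m) :=
    iIndepFun_pi (X := fun _ => id) fun _ => aemeasurable_id
  have hlaw : ∀ j, (columnLaw n m).map (X j) = scaledGaussian _ (1 / √n) := fun j =>
    (measurePreserving_eval _ j).map_eq
  set g : (Fin m → EuclideanSpace ℝ (Fin n)) → EuclideanSpace ℝ (Fin n) :=
    fun a => ∑ l ∈ U, z l • a l with hg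
  set Y : (Fin m → EuclideanSpace ℝ (Fin n)) → Fin m → EuclideanSpace ℝ (Fin n) :=
    fun a l => if l ∈ U then 0 else a l with hY
  have hgm : Measurable g := by fun_prop
  have hYm : Measurable Y := by
    refine measurable_pi_lambda _ fun l => ?_
    by_cases hl : l ∈ U
    · simp [hY, hl]
    · simpa [hY, hl] using measurable_pi_apply l
  have hgY : IndepFun g Y (columnLaw n m) := by
    have h := hind.indepFun_finset U Uᶜ disjoint_compl_right hXm
    have h1 : Measurable fun f : U → EuclideanSpace ℝ (Fin n) => ∑ l : U, z l • f l := by fun_prop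
    have h2 : Measurable fun (f : ↥(Uᶜ) → EuclideanSpace ℝ (Fin n)) (l : Fin m) =>
        if hl : l ∈ U then 0 else f ⟨l, by simpa using hl⟩ := by
      refine measurable_pi_lambda _ fun l => ?_
      by_cases hl : l ∈ U
      · simp [hl]
      · simpa [hl] using measurable_pi_apply _
    have := h.comp h1 h2
    convert! this using 1
    ext1 a
    exact (Finset.sum_coe_sort U fun l => z l • a l).symm
  have hglaw : (columnLaw n m).map g = scaledGaussian _ (√(∑ l ∈ U, z l ^ 2) / √n) := by
    have : IsProbabilityMeasure ((columnLaw n m).map g) :=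
      Measure.isProbabilityMeasure_map hgm.aemeasurable
    refine Measure.ext_of_charFun (funext fun t => ?_)
    have hind' : iIndepFun (fun l a => z l • X l a) (columnLaw n m) :=
      hind.comp (fun l v => z l • v) fun l => by fun_prop
    have := iIndepFun.charFun_map_fun_finsetSum_eq_prod (s := U) (P := columnLaw n m)
      (X := fun l a => z l • X l a) (fun l _ => by fun_prop) (hind'.restrict U)
    have hone : ∀ l, charFun ((columnLaw n m).map fun a => z l • X l a) t =
        Complex.exp (-(((1 / √n : ℝ) : ℂ) ^ 2 * ‖z l • t‖ ^ 2) / 2) := fun l => by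
      rw [charFun_map_smul_comp (hXm l).aemeasurable (z l) t, hlaw, charFun_scaledGaussian]
    rw [hg, this, Finset.prod_apply, Finset.prod_congr rfl fun l _ => hone l,
      charFun_scaledGaussian, ← Complex.exp_sum]
    congr 1
    have h1 : (√(∑ l ∈ U, z l ^ 2) / √n) ^ 2 = ∑ l ∈ U, (1 / √n) ^ 2 * z l ^ 2 := by
      rw [div_pow, Real.sq_sqrt (Finset.sum_nonneg fun _ _ => sq_nonneg _), Finset.sum_div]
      refine Finset.sum_congr rfl fun l _ => ?_
      ring
    rw [← Complex.ofReal_pow (√(∑ l ∈ U, z l ^ 2) / √n), h1]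
    have h2 : ∀ l, (‖z l • t‖ : ℂ) ^ 2 = z l ^ 2 * ‖t‖ ^ 2 := fun l => by
      rw [norm_smul, ← Complex.ofReal_pow, mul_pow, Real.norm_eq_abs, sq_abs]
      push_cast
      rfl
    simp_rw [h2]
    push_cast
    rw [Finset.sum_mul, ← Finset.sum_neg_distrib, Finset.sum_div]
    refine Finset.sum_congr rfl fun l _ => ?_
    ring
  have hmap := (indepFun_iff_map_prod_eq_prod_map_map hgm.aemeasurable hYm.aemeasurable).1 hgY
  have hp0 : 0 ≤ p := measureReal_nonneg.trans (hp 0)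
  have hYp : IsProbabilityMeasure ((columnLaw n m).map Y) :=
    Measure.isProbabilityMeasure_map hYm.aemeasurable
  have hset : {a | (∑ l ∈ U, z l • a l, fun l => if l ∈ U then 0 else a l) ∈ B} =
      (fun a => (g a, Y a)) ⁻¹' B := rfl
  rw [hset, ← map_measureReal_apply (hgm.prodMk hYm) hB, hmap, hglaw, measureReal_def,
    Measure.prod_apply_symm hB]
  refine ENNReal.toReal_le_of_le_ofReal hp0 ?_
  calc _ ≤ ∫⁻ _, ENNReal.ofReal p ∂((columnLaw n m).map Y) := by
        refine lintegral_mono fun b => ?_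
        rw [← ofReal_measureReal]
        exact ENNReal.ofReal_le_ofReal (hp b)
    _ = ENNReal.ofReal p := by simp

/-- The case of `columnLaw_real_le` in which a single column is singled out. -/
theorem columnLaw_real_le_single (j : Fin m)
    {B : Set (EuclideanSpace ℝ (Fin n) × (Fin m → EuclideanSpace ℝ (Fin n)))}
    (hB : MeasurableSet B) {p : ℝ}
    (hp : ∀ b, (scaledGaussian (EuclideanSpace ℝ (Fin n)) (1 / √n)).real {v | (v, b) ∈ B} ≤ p) :
    (columnLaw n m).real {a | (a j, Function.update a j 0) ∈ B} ≤ p := by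
  have h := columnLaw_real_le {j} 1 hB (p := p) (by simpa using hp)
  have hset : ∀ a : Fin m → EuclideanSpace ℝ (Fin n), (a j, Function.update a j 0) =
      (∑ l ∈ {j}, (1 : Fin m → ℝ) l • a l,
        fun l => if l ∈ ({j} : Finset (Fin m)) then 0 else a l) := by
    intro a
    refine Prod.ext (by simp) ?_
    ext1 l
    simp [Function.update_apply]
  simpa only [hset] using h

end Columns

/-! ### Probabilities of the exceptional events -/

section Events

open MeasureTheory ProbabilityTheory

variable {n m : ℕ}

theorem synth_eq_add_update (x : Fin m → ℝ) (a : Fin m → EuclideanSpace ℝ (Fin n)) (j : Fin m) :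
    synth x a = x j • a j + synth x (Function.update a j 0) := by
  rw [synth, synth, ← Finset.add_sum_erase _ _ (mem_univ j),
    ← Finset.add_sum_erase _ (fun l => x l • Function.update a j 0 l) (mem_univ j)]
  simp only [Function.update_self, smul_zero, zero_add]
  congr 1
  refine Finset.sum_congr rfl fun l hl => ?_
  rw [Function.update_of_ne (Finset.ne_of_mem_erase hl)]

theorem perp_update (a : Fin m → EuclideanSpace ℝ (Fin n)) {S : Finset (Fin m)} {j : Fin m}
    (hj : j ∉ S) : perp (Function.update a j 0) S = perp a S :=
  perp_congr fun l hl => Function.update_of_ne (fun h => hj (by rwa [h] at hl)) _ _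

theorem resid_eq_update (x : Fin m → ℝ) (a : Fin m → EuclideanSpace ℝ (Fin n))
    {S : Finset (Fin m)} {j : Fin m} (hj : j ∉ S) :
    resid x a S =
      perp (Function.update a j 0) S (x j • a j + synth x (Function.update a j 0)) := by
  rw [resid, perp_update a hj, synth_eq_add_update x a j]

theorem columnLaw_norm_perp_lt {S : Finset (Fin m)} (hn : 0 < n) (hS : 2 * S.card ≤ n)
    {l : Fin m} (hl : l ∉ S) :
    (columnLaw n m).real {a | ‖perp a S (a l)‖ < 1 / 4} ≤ Real.exp (-n / 8) := by
  have hB : MeasurableSet {p : EuclideanSpace ℝ (Fin n) × (Fin m → EuclideanSpace ℝ (Fin n)) |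
      ‖perp p.2 S p.1‖ < 1 / 4} := by
    have := measurable_perp (a := fun p : EuclideanSpace ℝ (Fin n) ×
      (Fin m → EuclideanSpace ℝ (Fin n)) => p.2) (fun j => by fun_prop) S measurable_fst
    exact measurableSet_lt this.norm measurable_const
  have h := columnLaw_real_le_single l hB (p := Real.exp (-n / 8)) fun b => by
    have hf := finrank_orthogonal_span_image b S
    rw [finrank_euclideanSpace_fin] at hf
    have := scaledGaussian_norm_starProjection_lt (Submodule.span ℝ (b '' S))ᗮ hn (by omega)
      one_pos
    rw [mul_one] at this
    exact this
  simpa [perp_update _ hl] using h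

/-- The residual is the projection of the combination of the columns outside `S`, a Gaussian vector
independent of the columns in `S`. -/
theorem columnLaw_norm_resid_lt (x : Fin m → ℝ) {S : Finset (Fin m)} (hn : 0 < n)
    (hS : 2 * S.card ≤ n) :
    (columnLaw n m).real {a | ‖resid x a S‖ < 1 / 4 * √(∑ l ∈ Sᶜ, x l ^ 2)} ≤
      Real.exp (-n / 8) := by
  rcases (Real.sqrt_nonneg (∑ l ∈ Sᶜ, x l ^ 2)).eq_or_lt with h0 | hρ
  · rw [← h0]
    have : {a : Fin m → EuclideanSpace ℝ (Fin n) | ‖resid x a S‖ < 1 / 4 * 0} = ∅ := by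
      ext a; simp
    rw [this, measureReal_empty]
    exact (Real.exp_pos _).le
  set ρ := √(∑ l ∈ Sᶜ, x l ^ 2) with hρdef
  have hB : MeasurableSet {p : EuclideanSpace ℝ (Fin n) × (Fin m → EuclideanSpace ℝ (Fin n)) |
      ‖perp p.2 S p.1‖ < 1 / 4 * ρ} := by
    have := measurable_perp (a := fun p : EuclideanSpace ℝ (Fin n) ×
      (Fin m → EuclideanSpace ℝ (Fin n)) => p.2) (fun j => by fun_prop) S measurable_fst
    exact measurableSet_lt this.norm measurable_const
  have h := columnLaw_real_le Sᶜ x hB (p := Real.exp (-n / 8)) fun b => by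
    have hf := finrank_orthogonal_span_image b S
    rw [finrank_euclideanSpace_fin] at hf
    exact scaledGaussian_norm_starProjection_lt (Submodule.span ℝ (b '' S))ᗮ hn (by omega) hρ
  refine le_of_eq_of_le ?_ h
  congr 1
  ext a
  have h1 : perp (fun l => if l ∈ Sᶜ then 0 else a l) S = perp a S :=
    perp_congr fun l hl => by simp [hl]
  have h2 : resid x a S = perp a S (∑ l ∈ Sᶜ, x l • a l) := by
    rw [resid, synth, ← Finset.sum_add_sum_compl S, map_add, map_sum]
    refine add_eq_right.2 (Finset.sum_eq_zero fun l hl => ?_)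
    rw [map_smul, perp_apply_mem hl, smul_zero]
  simp only [Set.mem_ofPred_eq, h1, h2]

theorem columnLaw_norm_gt (hn : 0 < n) (l : Fin m) :
    (columnLaw n m).real {a | 2 < ‖a l‖} ≤ Real.exp (-n / 8) := by
  have hB : MeasurableSet {p : EuclideanSpace ℝ (Fin n) × (Fin m → EuclideanSpace ℝ (Fin n)) |
      2 < ‖p.1‖} := measurableSet_lt (by fun_prop) (by fun_prop)
  exact columnLaw_real_le_single l hB fun b =>
    scaledGaussian_norm_gt hn finrank_euclideanSpace_fin

/-- A column off the support is nearly orthogonal to the residuals of its leave-one-out run, as it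
is independent of them. -/
theorem columnLaw_abs_inner_ge (x : Fin m → ℝ) (L i : ℕ) {τ : ℝ} (hτ : 0 ≤ τ) (hn : 0 < n)
    {j : Fin m} (hj : x j = 0) :
    (columnLaw n m).real {a | resid x a (leaveOneOut x a L j i) ≠ 0 ∧
      ‖resid x a (leaveOneOut x a L j i)‖ * τ ≤
        |inner ℝ (a j) (resid x a (leaveOneOut x a L j i))|} ≤
      2 * Real.exp (-(3 / 8 * (n * τ ^ 2))) := by
  have hB : MeasurableSet {p : EuclideanSpace ℝ (Fin n) × (Fin m → EuclideanSpace ℝ (Fin n)) |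
      resid x p.2 (leaveOneOut x p.2 L j i) ≠ 0 ∧
      ‖resid x p.2 (leaveOneOut x p.2 L j i)‖ * τ ≤
        |inner ℝ p.1 (resid x p.2 (leaveOneOut x p.2 L j i))|} := by
    have hm : ∀ l, Measurable fun p : EuclideanSpace ℝ (Fin n) ×
        (Fin m → EuclideanSpace ℝ (Fin n)) => p.2 l := fun l => by fun_prop
    have hset : {p : EuclideanSpace ℝ (Fin n) × (Fin m → EuclideanSpace ℝ (Fin n)) |
        resid x p.2 (leaveOneOut x p.2 L j i) ≠ 0 ∧
        ‖resid x p.2 (leaveOneOut x p.2 L j i)‖ * τ ≤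
          |inner ℝ p.1 (resid x p.2 (leaveOneOut x p.2 L j i))|} =
      ⋃ S : Finset (Fin m), {p | leaveOneOut x p.2 L j i = S} ∩
        ({p | resid x p.2 S = 0}ᶜ ∩ {p | ‖resid x p.2 S‖ * τ ≤ |inner ℝ p.1 (resid x p.2 S)|}) := by
      ext p
      simp
    rw [hset]
    refine MeasurableSet.iUnion fun S => (measurableSet_leaveOneOut_eq hm x L j i S).inter
      (MeasurableSet.inter ?_ ?_)
    · exact (measurable_resid hm x S (measurableSet_singleton 0)).compl
    · have h1 := measurable_resid hm x S
      have h2 := (measurable_fst (α := EuclideanSpace ℝ (Fin n))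
        (β := Fin m → EuclideanSpace ℝ (Fin n))).inner (𝕜 := ℝ) h1
      exact measurableSet_le (h1.norm.mul_const τ) (by simpa [Real.norm_eq_abs] using h2.norm)
  have h := columnLaw_real_le_single j hB
    (p := 2 * Real.exp (-(3 / 8 * (n * τ ^ 2)))) fun b => by
      by_cases h0 : resid x b (leaveOneOut x b L j i) = 0
      · refine le_of_eq_of_le ?_ (by positivity : (0 : ℝ) ≤ _)
        simp [h0]
      · exact (measureReal_mono fun v hv => hv.2).trans (scaledGaussian_abs_inner_ge hn h0 hτ)
  refine le_of_eq_of_le ?_ h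
  congr 1
  ext a
  have hne : ∀ l ≠ j, a l = Function.update a j 0 l := fun l hl =>
    (Function.update_of_ne hl _ _).symm
  have h1 : leaveOneOut x (Function.update a j 0) L j i = leaveOneOut x a L j i :=
    (leaveOneOut_congr L hj hne i).symm
  have h2 : resid x (Function.update a j 0) (leaveOneOut x a L j i) =
      resid x a (leaveOneOut x a L j i) :=
    (resid_congr hj (notMem_leaveOneOut x a L j i) hne).symm
  simp only [Set.mem_ofPred_eq, h1, h2]

/-! ### Degenerate configurations have probability zero -/

theorem finite_zeros_quartic {c₀ c₁ c₂ c₃ c₄ : ℝ} (h : c₁ ≠ 0 ∨ c₂ ≠ 0 ∨ c₄ ≠ 0) :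
    {s : ℝ | c₀ + c₁ * s + c₂ * s ^ 2 + c₃ * s ^ 3 + c₄ * s ^ 4 = 0}.Finite := by
  open Polynomial in
  set p : ℝ[X] := C c₀ + C c₁ * X + C c₂ * X ^ 2 + C c₃ * X ^ 3 + C c₄ * X ^ 4 with hp
  have hp0 : p ≠ 0 := by
    intro h0
    have h1 : p.coeff 1 = c₁ := by simp [hp, Polynomial.coeff_X_pow, Polynomial.coeff_C]
    have h2 : p.coeff 2 = c₂ := by simp [hp, Polynomial.coeff_X_pow]
    have h4 : p.coeff 4 = c₄ := by simp [hp, Polynomial.coeff_X_pow]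
    rw [h0, Polynomial.coeff_zero] at h1 h2 h4
    rcases h with h | h | h
    · exact h h1.symm
    · exact h h2.symm
    · exact h h4.symm
  refine (Polynomial.finite_setOfPred_isRoot hp0).subset fun s hs => ?_
  simpa [hp, Polynomial.IsRoot] using hs

theorem exists_mem_orthogonal {E : Type*} [NormedAddCommGroup E] [InnerProductSpace ℝ E]
    [FiniteDimensional ℝ E] {V : Submodule ℝ E} (hV : 2 ≤ Module.finrank ℝ V) (w : E) :
    ∃ d ∈ V, d ≠ 0 ∧ inner ℝ w d = 0 := by
  have hker : LinearMap.ker ((innerₛₗ ℝ w).comp V.subtype) ≠ ⊥ :=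
    LinearMap.ker_ne_bot_of_finrank_lt (by rw [Module.finrank_self]; omega)
  obtain ⟨d, hd, hd0⟩ := (Submodule.ne_bot_iff _).1 hker
  exact ⟨d, d.2, by simpa using hd0, by simpa using hd⟩

/-- If, for fixed other columns, the column `a l` can be moved in some direction such that an event
occurs at finitely many points of each line only, then this event has probability zero. -/
theorem columnLaw_eq_zero (hn : 0 < n) (l : Fin m)
    {B : Set (EuclideanSpace ℝ (Fin n) × (Fin m → EuclideanSpace ℝ (Fin n)))}
    (hB : MeasurableSet B)
    (h : ∀ b, (∃ d ≠ 0, ∀ v, {s : ℝ | (v + s • d, b) ∈ B}.Finite)) :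
    (columnLaw n m).real {a | (a l, Function.update a l 0) ∈ B} = 0 := by
  refine le_antisymm (columnLaw_real_le_single l hB fun b => ?_) measureReal_nonneg
  obtain ⟨d, hd, hfin⟩ := h b
  have hc : 1 / √(n : ℝ) ≠ 0 := by
    have : 0 < √(n : ℝ) := Real.sqrt_pos.2 (by exact_mod_cast hn)
    positivity
  have h0 : scaledGaussian (EuclideanSpace ℝ (Fin n)) (1 / √n) {v | (v, b) ∈ B} = 0 :=
    scaledGaussian_eq_zero_of_finite hc (measurable_prodMk_right hB) hd hfin
  rw [measureReal_def, h0, ENNReal.toReal_zero]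

/-- The residual is almost surely not orthogonal to an unselected column: for fixed other columns
this would be a nontrivial polynomial equation along a suitable line. -/
theorem columnLaw_inner_resid_eq_zero (x : Fin m → ℝ) {S : Finset (Fin m)} (hS : S.card + 2 ≤ n)
    {l : Fin m} (hl : l ∉ S) :
    (columnLaw n m).real {a | resid x a S ≠ 0 ∧ inner ℝ (a l) (resid x a S) = 0} = 0 := by
  have hB : MeasurableSet {p : EuclideanSpace ℝ (Fin n) × (Fin m → EuclideanSpace ℝ (Fin n)) |
      perp p.2 S (x l • p.1 + synth x p.2) ≠ 0 ∧
      inner ℝ p.1 (perp p.2 S (x l • p.1 + synth x p.2)) = 0} := by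
    have hm : ∀ l, Measurable fun p : EuclideanSpace ℝ (Fin n) ×
        (Fin m → EuclideanSpace ℝ (Fin n)) => p.2 l := fun l => by fun_prop
    have h1 := measurable_perp hm S ((measurable_fst.const_smul (x l)).add (measurable_synth hm x))
    exact (h1 (measurableSet_singleton 0)).compl.inter
      ((measurable_fst.inner (𝕜 := ℝ) h1) (measurableSet_singleton 0))
  have h := columnLaw_eq_zero (by omega) l hB fun b => by
    set y := synth x b with hy
    by_cases hx : x l = 0
    · -- the residual does not depend on the column; move the column along the residual
      by_cases h0 : perp b S y = 0
      · have : Nonempty (Fin n) := ⟨⟨0, by omega⟩⟩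
        obtain ⟨d, hd⟩ := exists_ne (0 : EuclideanSpace ℝ (Fin n))
        exact ⟨d, hd, fun v => by simp [hx, ← hy, h0]⟩
      · refine ⟨_, h0, fun v => (finite_zeros_quartic (c₀ := inner ℝ v (perp b S y))
          (c₁ := ‖perp b S y‖ ^ 2) (c₂ := 0) (c₃ := 0) (c₄ := 0)
          (Or.inl (by simpa using h0))).subset ?_⟩
        rintro s ⟨-, hs⟩
        simp only [hx, zero_smul, zero_add, ← hy, inner_add_left, inner_smul_left,
          RCLike.conj_to_real, real_inner_self_eq_norm_sq] at hs
        simp only [Set.mem_ofPred_eq]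
        linarith
    · have hf := finrank_orthogonal_span_image b S
      rw [finrank_euclideanSpace_fin] at hf
      obtain ⟨d, hdV, hd, -⟩ := exists_mem_orthogonal
        (V := (Submodule.span ℝ (b '' S))ᗮ) (by omega) 0
      have hPd : perp b S d = d := perp_of_mem hdV
      refine ⟨d, hd, fun v => (finite_zeros_quartic
        (c₀ := inner ℝ v (perp b S (x l • v + y)))
        (c₁ := inner ℝ d (perp b S (x l • v + y)) + x l * inner ℝ v d)
        (c₂ := x l * ‖d‖ ^ 2) (c₃ := 0) (c₄ := 0)
        (Or.inr (Or.inl (mul_ne_zero hx (by simpa using hd))))).subset ?_⟩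
      rintro s ⟨-, hs⟩
      have h1 : x l • (v + s • d) + y = (x l • v + y) + (x l * s) • d := by module
      rw [h1, map_add, map_smul, hPd] at hs
      simp only [inner_add_left, inner_add_right, inner_smul_left, inner_smul_right,
        RCLike.conj_to_real, real_inner_self_eq_norm_sq] at hs
      simp only [Set.mem_ofPred_eq]
      linarith
  simpa only [Set.mem_ofPred_eq, ← resid_eq_update x _ hl] using h

/-- Ties have probability zero: for fixed other columns a tie is a polynomial equation in the column
`a l`, and along a suitable direction orthogonal to the span of the columns in `S` it is
nontrivial. -/
theorem columnLaw_score_eq (x : Fin m → ℝ) {S : Finset (Fin m)} (hS : S.card + 2 ≤ n)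
    {l l' : Fin m} (hl : l ∉ S) (hne : l ≠ l') :
    (columnLaw n m).real {a | (resid x a S ≠ 0 ∧ perp a S (a l) ≠ 0 ∧ perp a S (a l') ≠ 0) ∧
      score x a S l = score x a S l'} = 0 := by
  -- the tie, freed from denominators and absolute values
  set B := {p : EuclideanSpace ℝ (Fin n) × (Fin m → EuclideanSpace ℝ (Fin n)) |
      (perp p.2 S (x l • p.1 + synth x p.2) ≠ 0 ∧ perp p.2 S (p.2 l') ≠ 0) ∧
      inner ℝ p.1 (perp p.2 S (x l • p.1 + synth x p.2)) ^ 2 * ‖perp p.2 S (p.2 l')‖ ^ 2 -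
      inner ℝ (p.2 l') (perp p.2 S (x l • p.1 + synth x p.2)) ^ 2 * ‖perp p.2 S p.1‖ ^ 2 = 0}
    with hBdef
  have hB : MeasurableSet B := by
    have hm : ∀ l, Measurable fun p : EuclideanSpace ℝ (Fin n) ×
        (Fin m → EuclideanSpace ℝ (Fin n)) => p.2 l := fun l => by fun_prop
    have h1 := measurable_perp hm S ((measurable_fst.const_smul (x l)).add (measurable_synth hm x))
    have h2 := measurable_perp hm S (hm l')
    have h3 := measurable_perp hm S measurable_fst
    have h4 := (measurable_fst.inner (𝕜 := ℝ) h1).pow_const 2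
    have h5 := ((hm l').inner (𝕜 := ℝ) h1).pow_const 2
    exact ((h1 (measurableSet_singleton 0)).compl.inter
      (h2 (measurableSet_singleton 0)).compl).inter
      (((h4.mul (h2.norm.pow_const 2)).sub (h5.mul (h3.norm.pow_const 2)))
        (measurableSet_singleton 0))
  have h := columnLaw_eq_zero (by omega) l hB fun b => by
    set y := synth x b with hy
    set w := perp b S (b l') with hw
    have hf := finrank_orthogonal_span_image b S
    rw [finrank_euclideanSpace_fin] at hf
    have hV : 2 ≤ Module.finrank ℝ (Submodule.span ℝ (b '' S))ᗮ := by omega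
    have : Nonempty (Fin n) := ⟨⟨0, by omega⟩⟩
    obtain ⟨d₀, hd₀⟩ := exists_ne (0 : EuclideanSpace ℝ (Fin n))
    by_cases hw0 : w = 0
    · refine ⟨d₀, hd₀, fun v => ?_⟩
      simp [hBdef, ← hw, hw0]
    have hwn : ‖w‖ ^ 2 ≠ 0 := by simpa using hw0
    have hnorm : ∀ v d : EuclideanSpace ℝ (Fin n), ∀ s : ℝ, perp b S d = d →
        ‖perp b S (v + s • d)‖ ^ 2 =
          ‖perp b S v‖ ^ 2 + 2 * s * inner ℝ (perp b S v) d + s ^ 2 * ‖d‖ ^ 2 := by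
      intro v d s hd
      rw [map_add, map_smul, hd, norm_add_sq_real, norm_smul, inner_smul_right, mul_pow,
        Real.norm_eq_abs, sq_abs]
      ring
    by_cases hx : x l = 0
    · -- neither the residual nor the score of `l'` depends on the column `a l`
      by_cases h0 : perp b S y = 0
      · refine ⟨d₀, hd₀, fun v => ?_⟩
        simp [hBdef, ← hy, hx, h0]
      set r := perp b S y with hr
      by_cases he : inner ℝ (b l') r = 0
      · refine ⟨r, h0, fun v => (finite_zeros_quartic (c₀ := inner ℝ v r)
          (c₁ := ‖r‖ ^ 2) (c₂ := 0) (c₃ := 0) (c₄ := 0) (Or.inl (by simpa using h0))).subset ?_⟩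
        rintro s ⟨-, hs⟩
        simp only [hx, zero_smul, zero_add, ← hy, ← hr, ← hw, he] at hs
        have h1 : inner ℝ (v + s • r) r = 0 := by simpa [hw0] using hs
        simp only [inner_add_left, inner_smul_left, RCLike.conj_to_real,
          real_inner_self_eq_norm_sq] at h1
        simp only [Set.mem_ofPred_eq]
        linarith
      · obtain ⟨d, hdV, hd, hdr⟩ := exists_mem_orthogonal hV r
        have hPd : perp b S d = d := perp_of_mem hdV
        refine ⟨d, hd, fun v => (finite_zeros_quartic
          (c₀ := inner ℝ v r ^ 2 * ‖w‖ ^ 2 - inner ℝ (b l') r ^ 2 * ‖perp b S v‖ ^ 2)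
          (c₁ := -(inner ℝ (b l') r ^ 2 * (2 * inner ℝ (perp b S v) d)))
          (c₂ := -(inner ℝ (b l') r ^ 2 * ‖d‖ ^ 2)) (c₃ := 0) (c₄ := 0)
          (Or.inr (Or.inl ?_))).subset ?_⟩
        · exact neg_ne_zero.2 (mul_ne_zero (pow_ne_zero 2 he) (by simpa using hd))
        rintro s ⟨-, hs⟩
        rw [real_inner_comm] at hdr
        simp only [hx, zero_smul, zero_add, ← hy, ← hr, ← hw, hnorm v d s hPd, inner_add_left,
          inner_smul_left, RCLike.conj_to_real, hdr, mul_zero, add_zero] at hs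
        simp only [Set.mem_ofPred_eq]
        linarith
    · -- moving the column orthogonally to `w` keeps the numerator `e` of the score of `l'` fixed,
      -- so the term of degree four comes from the score of `l` only
      obtain ⟨d, hdV, hd, hdw⟩ := exists_mem_orthogonal hV w
      have hPd : perp b S d = d := perp_of_mem hdV
      have hbd : inner ℝ (b l') d = 0 := by rw [← hPd, ← inner_perp_left, ← hw, hdw]
      refine ⟨d, hd, fun v => ?_⟩
      set r := perp b S (x l • v + y) with hr
      set e := inner ℝ (b l') r with he
      set α := inner ℝ v r with hα
      set δ := inner ℝ d r + x l * inner ℝ v d with hδ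
      refine (finite_zeros_quartic
        (c₀ := α ^ 2 * ‖w‖ ^ 2 - e ^ 2 * ‖perp b S v‖ ^ 2)
        (c₁ := 2 * α * δ * ‖w‖ ^ 2 - e ^ 2 * (2 * inner ℝ (perp b S v) d))
        (c₂ := (δ ^ 2 + 2 * α * (x l * ‖d‖ ^ 2)) * ‖w‖ ^ 2 - e ^ 2 * ‖d‖ ^ 2)
        (c₃ := 2 * δ * (x l * ‖d‖ ^ 2) * ‖w‖ ^ 2)
        (c₄ := (x l * ‖d‖ ^ 2) ^ 2 * ‖w‖ ^ 2) (Or.inr (Or.inr ?_))).subset ?_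
      · exact mul_ne_zero (pow_ne_zero 2 (mul_ne_zero hx (by simpa using hd))) hwn
      rintro s ⟨-, hs⟩
      have h1 : perp b S (x l • (v + s • d) + y) = r + (x l * s) • d := by
        have : x l • (v + s • d) + y = (x l • v + y) + (x l * s) • d := by module
        rw [this, map_add, map_smul, hPd]
      have h2 : inner ℝ (v + s • d) (r + (x l * s) • d) = α + δ * s + x l * ‖d‖ ^ 2 * s ^ 2 := by
        simp only [inner_add_left, inner_add_right, inner_smul_left, inner_smul_right,
          RCLike.conj_to_real, real_inner_self_eq_norm_sq, hδ, hα]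
        ring
      have h3 : inner ℝ (b l') (r + (x l * s) • d) = e := by
        rw [inner_add_right, inner_smul_right, hbd, mul_zero, add_zero]
      simp only [← hy, ← hw] at hs
      rw [h1, h2, h3, hnorm v d s hPd] at hs
      simp only [Set.mem_ofPred_eq]
      linarith
  refine le_antisymm ((measureReal_mono ?_).trans h.le) measureReal_nonneg
  rintro a ⟨⟨h1, h2, h3⟩, h4⟩
  have hb : Function.update a l 0 l' = a l' := Function.update_of_ne hne.symm _ _
  simp only [hBdef, Set.mem_ofPred_eq]
  rw [← resid_eq_update x a hl, perp_update a hl, hb]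
  refine ⟨⟨h1, h3⟩, ?_⟩
  rw [score, score, div_eq_div_iff (norm_ne_zero_iff.2 h2) (norm_ne_zero_iff.2 h3)] at h4
  have h5 := congrArg (· ^ 2) h4
  simp only [mul_pow, sq_abs] at h5
  rw [h5, sub_self]

end Events

/-! ### The union bound -/

section UnionBound

open MeasureTheory ProbabilityTheory

variable {n m : ℕ}

theorem measureReal_exists_mem_le {α ι : Type*} [MeasurableSpace α] (μ : Measure α)
    [IsFiniteMeasure μ] (s : Finset ι) {R : ι → α → Prop} {c : ℝ}
    (h : ∀ i ∈ s, μ.real {a | R i a} ≤ c) : μ.real {a | ∃ i ∈ s, R i a} ≤ s.card * c := by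
  have hset : {a | ∃ i ∈ s, R i a} = ⋃ i ∈ s, {a | R i a} := by ext a; simp
  rw [hset]
  refine (measureReal_biUnion_finset_le s _).trans ((Finset.sum_le_sum h).trans ?_)
  rw [Finset.sum_const, nsmul_eq_mul]

/-- A set of at most `p` elements is the set of values of a map from `Fin p` with values in
`Option (Fin m)`. -/
theorem card_filter_card_le (m p : ℕ) :
    (univ.filter fun S : Finset (Fin m) => S.card ≤ p).card ≤ (m + 1) ^ p := by
  classical
  have : (m + 1) ^ p = (univ : Finset (Fin p → Option (Fin m))).card := by simp
  rw [this]
  refine Finset.card_le_card_of_surjOn (fun f => univ.filter fun j => ∃ i, f i = some j) ?_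
  intro S hS
  have hS' : S.card ≤ p := by simpa using hS
  refine ⟨fun i => if h : (i : ℕ) < S.card then some (S.equivFin.symm ⟨i, h⟩) else none,
    by simp, ?_⟩
  ext j
  simp only [mem_filter, mem_univ, true_and]
  constructor
  · rintro ⟨i, hi⟩
    split_ifs at hi with h
    rw [Option.some_inj] at hi
    exact hi ▸ Subtype.coe_prop _
  · intro hj
    have hlt := (S.equivFin ⟨j, hj⟩).isLt
    exact ⟨⟨S.equivFin ⟨j, hj⟩, hlt.trans_le hS'⟩, by simp⟩

/-- The union bound over all exceptional events. -/
theorem columnLaw_not_wellBehaved_le (x : Fin m → ℝ) {k L : ℕ} (hk : 1 ≤ k)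
    (hn : 2 * (k * L) + 2 ≤ n) :
    (columnLaw n m).real {a | ¬ WellBehaved x a k L} ≤
      ((m + 1) ^ (k * L) * m + (m + 1) ^ (k * L) + m) * Real.exp (-n / 8) +
      k * m * (2 * Real.exp (-(3 / 8 * (n / (1024 * k))))) := by
  classical
  set q := Real.exp (-n / 8) with hq
  have hq0 : 0 ≤ q := (Real.exp_pos _).le
  set μ := columnLaw n m
  set 𝒮 : Finset (Finset (Fin m)) := univ.filter fun S => S.card ≤ k * L with h𝒮
  have hN : (𝒮.card : ℝ) ≤ (m + 1) ^ (k * L) := by exact_mod_cast card_filter_card_le m (k * L)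
  have hmem : ∀ S, S ∈ 𝒮 ↔ S.card ≤ k * L := fun S => by simp [h𝒮]
  set τ : ℝ := 1 / (32 * √k) with hτ
  have hk' : (0 : ℝ) < k := by exact_mod_cast hk
  have hn0 : 0 < n := by omega
  obtain ⟨B₁, g₁, h₁⟩ : ∃ B, (∀ a ∉ B, ∀ S : Finset (Fin m), S.card ≤ k * L → ∀ l ∉ S,
      1 / 4 ≤ ‖perp a S (a l)‖) ∧ μ.real B ≤ (m + 1) ^ (k * L) * m * q := by
    refine ⟨{a | ∃ p ∈ (𝒮 ×ˢ (univ : Finset (Fin m))).filter fun p => p.2 ∉ p.1,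
      ‖perp a p.1 (a p.2)‖ < 1 / 4}, fun a ha S hS l hl => ?_, ?_⟩
    · by_contra hlt
      exact ha ⟨(S, l), by simp [hmem, hS, hl], not_le.1 hlt⟩
    refine (measureReal_exists_mem_le μ _ fun p hp => ?_).trans
      (mul_le_mul_of_nonneg_right ?_ hq0)
    · simp only [mem_filter, mem_product, hmem] at hp
      exact columnLaw_norm_perp_lt hn0 (by omega) hp.2
    · refine le_trans (Nat.cast_le.2 (Finset.card_filter_le _ _)) ?_
      rw [Finset.card_product, Finset.card_univ, Fintype.card_fin, Nat.cast_mul]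
      gcongr
  obtain ⟨B₂, g₂, h₂⟩ : ∃ B, (∀ a ∉ B, ∀ S : Finset (Fin m), S.card ≤ k * L →
      1 / 4 * √(∑ l ∈ Sᶜ, x l ^ 2) ≤ ‖resid x a S‖) ∧ μ.real B ≤ (m + 1) ^ (k * L) * q := by
    refine ⟨{a | ∃ S ∈ 𝒮, ‖resid x a S‖ < 1 / 4 * √(∑ l ∈ Sᶜ, x l ^ 2)}, fun a ha S hS => ?_, ?_⟩
    · by_contra hlt
      exact ha ⟨S, (hmem S).2 hS, not_le.1 hlt⟩
    exact (measureReal_exists_mem_le μ _ fun S hS => columnLaw_norm_resid_lt x hn0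
      (by rw [hmem] at hS; omega)).trans (mul_le_mul_of_nonneg_right hN hq0)
  obtain ⟨B₃, g₃, h₃⟩ : ∃ B, (∀ a ∉ B, ∀ l, ‖a l‖ ≤ 2) ∧ μ.real B ≤ m * q := by
    refine ⟨{a | ∃ l ∈ (univ : Finset (Fin m)), 2 < ‖a l‖}, fun a ha l => ?_, ?_⟩
    · by_contra hlt
      exact ha ⟨l, mem_univ l, not_le.1 hlt⟩
    exact (measureReal_exists_mem_le μ _ fun l _ => columnLaw_norm_gt hn0 l).trans (by simp [hq])
  obtain ⟨B₄, g₄, h₄⟩ : ∃ B, (∀ a ∉ B, ∀ S : Finset (Fin m), S.card ≤ k * L → ∀ l ∉ S,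
      resid x a S ≠ 0 → inner ℝ (a l) (resid x a S) ≠ 0) ∧ μ.real B ≤ 0 := by
    refine ⟨{a | ∃ p ∈ (𝒮 ×ˢ (univ : Finset (Fin m))).filter fun p => p.2 ∉ p.1,
      resid x a p.1 ≠ 0 ∧ inner ℝ (a p.2) (resid x a p.1) = 0},
      fun a ha S hS l hl h0 heq => ha ⟨(S, l), by simp [hmem, hS, hl], h0, heq⟩, ?_⟩
    refine (measureReal_exists_mem_le μ _ (c := 0) fun p hp => ?_).trans (by simp)
    simp only [mem_filter, mem_product, hmem] at hp
    exact (columnLaw_inner_resid_eq_zero x (by omega) hp.2).le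
  obtain ⟨B₅, g₅, h₅⟩ : ∃ B, (∀ a ∉ B, ∀ S : Finset (Fin m), S.card ≤ k * L → ∀ l ∉ S, ∀ l',
      l ≠ l' → resid x a S ≠ 0 → perp a S (a l) ≠ 0 → perp a S (a l') ≠ 0 →
      score x a S l ≠ score x a S l') ∧ μ.real B ≤ 0 := by
    refine ⟨{a | ∃ p ∈ (𝒮 ×ˢ (univ : Finset (Fin m × Fin m))).filter
        fun p => p.2.1 ∉ p.1 ∧ p.2.1 ≠ p.2.2,
        (resid x a p.1 ≠ 0 ∧ perp a p.1 (a p.2.1) ≠ 0 ∧ perp a p.1 (a p.2.2) ≠ 0) ∧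
          score x a p.1 p.2.1 = score x a p.1 p.2.2},
      fun a ha S hS l hl l' hne h0 hp hp' heq =>
        ha ⟨(S, l, l'), by simp [hmem, hS, hl, hne], ⟨h0, hp, hp'⟩, heq⟩, ?_⟩
    refine (measureReal_exists_mem_le μ _ (c := 0) fun p hp => ?_).trans (by simp)
    simp only [mem_filter, mem_product, hmem] at hp
    exact (columnLaw_score_eq x (by omega) hp.2.1 hp.2.2).le
  obtain ⟨B₆, g₆, h₆⟩ : ∃ B, (∀ a ∉ B, ∀ j, x j = 0 → ∀ i < k,
      resid x a (leaveOneOut x a L j i) ≠ 0 →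
      |inner ℝ (a j) (resid x a (leaveOneOut x a L j i))| <
        ‖resid x a (leaveOneOut x a L j i)‖ * τ) ∧
      μ.real B ≤ k * m * (2 * Real.exp (-(3 / 8 * (n / (1024 * k))))) := by
    refine ⟨{a | ∃ p ∈ (range k ×ˢ (univ : Finset (Fin m))).filter fun p => x p.2 = 0,
        resid x a (leaveOneOut x a L p.2 p.1) ≠ 0 ∧
        ‖resid x a (leaveOneOut x a L p.2 p.1)‖ * τ ≤
          |inner ℝ (a p.2) (resid x a (leaveOneOut x a L p.2 p.1))|},
      fun a ha j hj i hi h0 => ?_, ?_⟩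
    · by_contra hlt
      exact ha ⟨(i, j), by simp [hi, hj], h0, not_lt.1 hlt⟩
    refine (measureReal_exists_mem_le μ _ fun p hp => ?_).trans
      (mul_le_mul_of_nonneg_right (?_ : _ ≤ (k * m : ℝ)) (by positivity))
    · simp only [mem_filter, mem_product] at hp
      have h := columnLaw_abs_inner_ge (n := n) x L p.1 (τ := τ) (by positivity) hn0 hp.2
      have hsq : (n : ℝ) * τ ^ 2 = n / (1024 * k) := by
        rw [hτ, div_pow, mul_pow, Real.sq_sqrt hk'.le]; ring
      rwa [hsq] at h
    · refine le_trans (Nat.cast_le.2 (Finset.card_filter_le _ _)) ?_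
      rw [Finset.card_product, Finset.card_univ, Fintype.card_fin, Finset.card_range,
        Nat.cast_mul]
  have hsub : {a | ¬ WellBehaved x a k L} ⊆ B₁ ∪ B₂ ∪ B₃ ∪ B₄ ∪ B₅ ∪ B₆ := by
    intro a ha
    by_contra hgood
    simp only [Set.mem_union, not_or] at hgood
    obtain ⟨⟨⟨⟨⟨n₁, n₂⟩, n₃⟩, n₄⟩, n₅⟩, n₆⟩ := hgood
    have hperp : ∀ S : Finset (Fin m), S.card ≤ k * L → ∀ l ∉ S, perp a S (a l) ≠ 0 := by
      intro S hS l hl h0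
      have := g₁ a n₁ S hS l hl
      rw [h0, norm_zero] at this
      norm_num at this
    refine ha ⟨g₁ a n₁, g₂ a n₂, g₃ a n₃, g₄ a n₄, fun S hS l hl l' hl' hne h0 =>
      g₅ a n₅ S hS l hl l' hne h0 (hperp S hS l hl) (hperp S hS l' hl'), fun j hj i hi h0 => ?_⟩
    have := g₆ a n₆ j hj i hi h0
    rwa [hτ, mul_one_div] at this
  calc μ.real {a | ¬ WellBehaved x a k L} ≤ μ.real (B₁ ∪ B₂ ∪ B₃ ∪ B₄ ∪ B₅ ∪ B₆) :=
        measureReal_mono hsub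
    _ ≤ μ.real B₁ + μ.real B₂ + μ.real B₃ + μ.real B₄ + μ.real B₅ + μ.real B₆ := by
        grw [measureReal_union_le, measureReal_union_le, measureReal_union_le,
          measureReal_union_le, measureReal_union_le]
    _ ≤ _ := by linarith

/-- The failure probability in `columnLaw_not_wellBehaved_le`, for sufficiently large `n`. -/
theorem failure_bound_lt {n m k L : ℕ} {β : ℝ} (hk : 1 ≤ k) (hL : 1 ≤ L) (hm : 2 ≤ m)
    (hkm : k ≤ m) (hβ0 : 0 < β) (hβ1 : β < 1)
    (hn : 2 ^ 17 * L * k * Real.log (m / β) ≤ n) :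
    ((m + 1) ^ (k * L) * m + (m + 1) ^ (k * L) + m) * Real.exp (-n / 8) +
      k * m * (2 * Real.exp (-(3 / 8 * (n / (1024 * k))))) < β ^ 2 := by
  set ℓ := Real.log (m / β) with hℓ
  have hm' : (2 : ℝ) ≤ m := by exact_mod_cast hm
  have hk' : (1 : ℝ) ≤ k := by exact_mod_cast hk
  have hL' : (1 : ℝ) ≤ L := by exact_mod_cast hL
  have hM : (m : ℝ) ≤ m / β := by rw [le_div_iff₀ hβ0]; nlinarith
  have hexp : Real.exp ℓ = m / β := Real.exp_log (by positivity)
  have hℓ0 : 0 < ℓ := Real.log_pos (by linarith)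
  have hmle : (m : ℝ) ≤ Real.exp ℓ := hexp ▸ hM
  have hkL : 1 ≤ (k : ℝ) * L := by nlinarith
  have hpow : ((m : ℝ) + 1) ^ (k * L) ≤ Real.exp (2 * (k * L) * ℓ) := by
    have h1 : (m : ℝ) + 1 ≤ Real.exp (2 * ℓ) := by
      have : Real.exp (2 * ℓ) = Real.exp ℓ * Real.exp ℓ := by rw [← Real.exp_add]; ring_nf
      rw [this]
      nlinarith
    calc ((m : ℝ) + 1) ^ (k * L) ≤ Real.exp (2 * ℓ) ^ (k * L) := by gcongr
      _ = _ := by rw [← Real.exp_nat_mul]; push_cast; ring_nf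
  have hq : Real.exp (-n / 8) ≤ Real.exp (-(9 * (k * L) * ℓ)) := by
    rw [Real.exp_le_exp]
    have : 0 ≤ (k : ℝ) * L * ℓ := by positivity
    nlinarith
  have hone : ∀ c : ℝ, 6 ≤ c → Real.exp (-(c * ℓ)) ≤ Real.exp (-(6 * ℓ)) := fun c hc => by
    rw [Real.exp_le_exp]; nlinarith
  have t1 : ((m : ℝ) + 1) ^ (k * L) * m * Real.exp (-n / 8) ≤ Real.exp (-(6 * ℓ)) := by
    calc _ ≤ Real.exp (2 * (k * L) * ℓ) * Real.exp ℓ * Real.exp (-(9 * (k * L) * ℓ)) := by gcongr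
      _ = Real.exp (-((7 * (k * L) - 1) * ℓ)) := by
        rw [← Real.exp_add, ← Real.exp_add]; ring_nf
      _ ≤ _ := hone _ (by linarith)
  have t2 : ((m : ℝ) + 1) ^ (k * L) * Real.exp (-n / 8) ≤ Real.exp (-(6 * ℓ)) := by
    calc _ ≤ Real.exp (2 * (k * L) * ℓ) * Real.exp (-(9 * (k * L) * ℓ)) := by gcongr
      _ = Real.exp (-((7 * (k * L)) * ℓ)) := by rw [← Real.exp_add]; ring_nf
      _ ≤ _ := hone _ (by linarith)
  have t3 : (m : ℝ) * Real.exp (-n / 8) ≤ Real.exp (-(6 * ℓ)) := by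
    calc _ ≤ Real.exp ℓ * Real.exp (-(9 * (k * L) * ℓ)) := by gcongr
      _ = Real.exp (-((9 * (k * L) - 1) * ℓ)) := by rw [← Real.exp_add]; ring_nf
      _ ≤ _ := hone _ (by linarith)
  have t4 : (k : ℝ) * m * (2 * Real.exp (-(3 / 8 * (n / (1024 * k))))) ≤ Real.exp (-(6 * ℓ)) := by
    have h1 : Real.exp (-(3 / 8 * (n / (1024 * k)))) ≤ Real.exp (-(9 * ℓ)) := by
      rw [Real.exp_le_exp]
      have h2 : 2 ^ 7 * ℓ ≤ n / (1024 * k) := by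
        rw [le_div_iff₀ (by positivity)]
        have : 0 ≤ (k : ℝ) * ℓ := by positivity
        nlinarith
      linarith
    have h2 : (k : ℝ) ≤ m := by exact_mod_cast hkm
    calc _ ≤ Real.exp ℓ * Real.exp ℓ * (Real.exp ℓ * Real.exp (-(9 * ℓ))) := by
          gcongr <;> linarith
      _ = _ := by rw [← Real.exp_add, ← Real.exp_add, ← Real.exp_add]; ring_nf
  have hfin : 4 * Real.exp (-(6 * ℓ)) < β ^ 2 := by
    have h1 : Real.exp (-(6 * ℓ)) = (β / m) ^ 6 := by
      rw [show -(6 * ℓ) = ((6 : ℕ) : ℝ) * (-ℓ) by push_cast; ring, Real.exp_nat_mul,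
        Real.exp_neg, hexp, inv_div]
    have h2 : β / m ≤ β / 2 := by gcongr
    have h3 : β / m ≤ 1 / 2 := by linarith
    have h0 : 0 ≤ β / m := by positivity
    rw [h1]
    calc 4 * (β / m) ^ 6 = 4 * ((β / m) ^ 4 * (β / m) ^ 2) := by ring
      _ ≤ 4 * ((1 / 2) ^ 4 * (β / 2) ^ 2) := by gcongr
      _ < β ^ 2 := by nlinarith [sq_pos_of_pos hβ0]
  nlinarith

/-- Recovery with probability exceeding `1 - β ^ 2` from a number of measurements of the order
`k log (m / β)`. -/
theorem recoversWithProb {n m k L : ℕ} {β : ℝ} (hk : 1 ≤ k) (hL : 1 ≤ L) (hnm : n < m)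
    (hβ0 : 0 < β) (hβ1 : β < 1) (hn : 2 ^ 17 * L * k * Real.log (m / β) ≤ n) :
    RecoversWithProb.{u} n m k L (1 - β ^ 2) := by
  intro Ω _ P _ A hA x hx
  have hkL : 1 ≤ k * L := Nat.one_le_iff_ne_zero.2 (by positivity)
  have hm1 : 1 ≤ m := by omega
  have hm' : (1 : ℝ) ≤ m := by exact_mod_cast hm1
  -- `m ≥ 2`, since `m = 1` would give `n = 0` and `log (m / β) > 0`
  have hm2 : 2 ≤ m := by
    by_contra hlt
    have h0 : n = 0 := by omega
    have hlog : 0 < Real.log (m / β) := Real.log_pos (by rw [one_lt_div hβ0]; linarith)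
    rw [h0, Nat.cast_zero] at hn
    have : (0 : ℝ) < 2 ^ 17 * L * k * Real.log (m / β) := by
      have : (0 : ℝ) < L := by exact_mod_cast hL
      have : (0 : ℝ) < k := by exact_mod_cast hk
      positivity
    linarith
  have hm2' : (2 : ℝ) ≤ m := by exact_mod_cast hm2
  have hn4 : 4 * (k * L) ≤ n := by
    have hlog : 1 / 2 ≤ Real.log (m / β) := by
      have h1 : Real.log 2 ≤ Real.log (m / β) := by
        refine Real.log_le_log (by norm_num) ?_
        rw [le_div_iff₀ hβ0]; nlinarith
      linarith [Real.log_two_gt_d9]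
    have h2 : (1 : ℝ) ≤ k * L := by exact_mod_cast hkL
    have : (4 : ℝ) * (k * L) ≤ n := by nlinarith
    exact_mod_cast this
  have hkm : k ≤ m := by nlinarith
  have hbad := (columnLaw_not_wellBehaved_le x hk (by omega)).trans_lt
    (failure_bound_lt hk hL hm2 hkm hβ0 hβ1 hn)
  have hlaw := hasLaw_column hA
  set T := toMeasurable (columnLaw n m) {a | ¬ WellBehaved x a k L} with hT
  have hTm : MeasurableSet T := measurableSet_toMeasurable _ _
  have hPT : P.real {ω | column (A ω) ∈ T} < β ^ 2 := by
    rw [hlaw.measureReal_eq (p := fun a => a ∈ T) hTm]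
    have : (columnLaw n m).real {a | a ∈ T} = (columnLaw n m).real {a | ¬ WellBehaved x a k L} := by
      rw [measureReal_def, measureReal_def]
      exact congrArg _ (measure_toMeasurable _)
    rwa [this]
  have hcover : (Set.univ : Set Ω) ⊆
      {ω | Recovers (A ω) x k L} ∪ {ω | column (A ω) ∈ T} := by
    intro ω _
    by_cases hω : column (A ω) ∈ T
    · exact Or.inr hω
    · refine Or.inl ?_
      have hgood : WellBehaved x (column (A ω)) k L := by
        by_contra hb
        exact hω (subset_toMeasurable _ _ hb)
      exact hgood.recovers hx hL (by omega)
  have h1 : (1 : ℝ) ≤ P.real {ω | Recovers (A ω) x k L} + P.real {ω | column (A ω) ∈ T} := by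
    rw [← probReal_univ (μ := P)]
    exact (measureReal_mono hcover).trans (measureReal_union_le _ _)
  linarith

end UnionBound

end AOLS

theorem corollary2 (L : ℕ) (hL : 1 ≤ L) :
    (∃ C₁ C₂ C₃ : ℝ, 0 < C₁ ∧ 0 < C₂ ∧ 0 < C₃ ∧
      ∀ (k n m : ℕ) (β : ℝ), 1 ≤ k → L ≤ n / k → n < m →
        ((k : ℝ) + L - 1) ^ (3 / 2 : ℝ) < m → 0 < β → β < 1 →
        max (6 / C₁ * k * Real.log (m / (((k : ℝ) + L - 1) * β ^ (1 / 3 : ℝ))))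
          ((C₂ * k + Real.log (8 / β ^ 2)) / C₃) ≤ n →
        AOLS.RecoversWithProb.{u} n m k L (1 - β ^ 2)) ∧
    (∀ β : ℝ, 0 < β → β < 1 → ∃ C : ℝ, 0 < C ∧
      ∀ k n m : ℕ, 1 ≤ k → L ≤ n / k → n < m →
        ((k : ℝ) + L - 1) ^ (3 / 2 : ℝ) < m →
        C * k * Real.log (m / ((k : ℝ) + L - 1)) ≤ n →
        AOLS.RecoversWithProb.{u} n m k L (1 - β ^ 2)) := by
  have hL' : (1 : ℝ) ≤ L := by exact_mod_cast hL
  -- `log (m / (k + L - 1))` is at least `log m / 3` by the assumption on `m`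
  have hlog : ∀ k m : ℕ, 1 ≤ k → ((k : ℝ) + L - 1) ^ (3 / 2 : ℝ) < m →
      1 ≤ (k : ℝ) + L - 1 ∧ 0 < (m : ℝ) ∧
        Real.log m / 3 ≤ Real.log m - Real.log ((k : ℝ) + L - 1) := by
    intro k m hk hm
    have hk' : (1 : ℝ) ≤ k := by exact_mod_cast hk
    have hs : 1 ≤ (k : ℝ) + L - 1 := by linarith
    have hm0 : (0 : ℝ) < m := (Real.rpow_pos_of_pos (by linarith) _).trans hm
    have h := Real.log_lt_log (Real.rpow_pos_of_pos (by linarith) _) hm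
    rw [Real.log_rpow (by linarith)] at h
    exact ⟨hs, hm0, by linarith⟩
  constructor
  · -- for this `C₁` the first term of the maximum alone is at least `2 ^ 17 * L * k * log (m / β)`
    refine ⟨1 / (2 ^ 16 * L), 1, 1, by positivity, one_pos, one_pos, ?_⟩
    intro k n m β hk _ hnm hm hβ0 hβ1 hn
    obtain ⟨hs, hm0, hlm⟩ := hlog k m hk hm
    refine AOLS.recoversWithProb hk hL hnm hβ0 hβ1 (le_trans ?_ ((le_max_left _ _).trans hn))
    have hβ3 : (0 : ℝ) < β ^ (1 / 3 : ℝ) := Real.rpow_pos_of_pos hβ0 _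
    have hs0 : (0 : ℝ) < (k : ℝ) + L - 1 := by linarith
    rw [Real.log_div hm0.ne' hβ0.ne', Real.log_div hm0.ne' (mul_pos hs0 hβ3).ne',
      Real.log_mul hs0.ne' hβ3.ne', Real.log_rpow hβ0]
    calc 2 ^ 17 * (L : ℝ) * k * (Real.log m - Real.log β)
        = 6 / (1 / (2 ^ 16 * (L : ℝ))) * k * (Real.log m / 3 - 1 / 3 * Real.log β) := by
          field_simp; ring
      _ ≤ _ := by
          refine mul_le_mul_of_nonneg_left ?_ (by positivity)
          linarith
  · intro β hβ0 hβ1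
    have hlβ : 0 < -Real.log β := neg_pos.2 (Real.log_neg hβ0 hβ1)
    have hl2 : 0 < Real.log 2 := Real.log_pos (by norm_num)
    refine ⟨2 ^ 17 * L * (3 * (1 + -Real.log β / Real.log 2)), by positivity, ?_⟩
    intro k n m hk hLn hnm hm hn
    obtain ⟨hs, hm0, hlm⟩ := hlog k m hk hm
    refine AOLS.recoversWithProb hk hL hnm hβ0 hβ1 (le_trans ?_ hn)
    have hm2 : (2 : ℝ) ≤ m := by
      have hn1 : n ≠ 0 := by
        rintro rfl
        simp at hLn
        omega
      exact_mod_cast (by omega : 2 ≤ m)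
    have hlm2 : Real.log 2 ≤ Real.log m := Real.log_le_log (by norm_num) hm2
    rw [Real.log_div hm0.ne' hβ0.ne', Real.log_div hm0.ne' (by linarith)]
    have hβm : -Real.log β ≤ -Real.log β / Real.log 2 * Real.log m := by
      rw [div_mul_eq_mul_div, le_div_iff₀ hl2]
      exact mul_le_mul_of_nonneg_left hlm2 hlβ.le
    have hc : 0 ≤ 1 + -Real.log β / Real.log 2 := by positivity
    calc 2 ^ 17 * (L : ℝ) * k * (Real.log m - Real.log β)
        ≤ 2 ^ 17 * (L : ℝ) * k * ((1 + -Real.log β / Real.log 2) * Real.log m) := by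
          refine mul_le_mul_of_nonneg_left ?_ (by positivity)
          linarith
      _ = 2 ^ 17 * (L : ℝ) * k * ((3 * (1 + -Real.log β / Real.log 2)) * (Real.log m / 3)) := by
          ring
      _ ≤ 2 ^ 17 * (L : ℝ) * k * ((3 * (1 + -Real.log β / Real.log 2)) *
            (Real.log m - Real.log ((k : ℝ) + L - 1))) := by gcongr
      _ = _ := by ring
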